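/- **Setting.** Let $U\subseteq\mathbb C$ be open and $\omega_*\in U$. For $\omega\in U$ consider on $0<z<1$ the equation $\Psi''+P(z;\omega)\Psi'+Q(z;\omega)\Psi=0$, and suppose that the substitution $\Psi=z^{\rho_0(\omega)}(1-z)^{\rho_1(\omega)}f$ reduces it exactly to the Gauss equation $$z(1-z)f''+[c-(a+b+1)z]f'-ab\,f=0,\qquad a=a(\omega),\ b=b(\omega),\ c=c(\omega),$$ where $c(\omega)\notin\{0,-1,-2,\dots\}$. Let $w(z;\omega)=\exp\left(\int^z P(\zeta;\omega)\,d\zeta\right)$, where the indefinite integral depends analytically on $\omega\in U$ for each fixed $z$ (which is automatic if, as usual, $P$ and the integral do not depend on $\omega$). Let $(\alpha,\beta)\in\mathbb C^2\setminus\{(0,0)\}$ be constants and put $$R_{\rm in}=z^{\rho_0}(1-z)^{\rho_1}{}_2F_1(a,b;c;z),\qquad R_{\rm slow}=z^{\rho_0}(1-z)^{\rho_1}{}_2F_1(a,b;a+b-c+1;1-z),$$ $$R_{\rm fast}=z^{\rho_0}(1-z)^{\rho_1+c-a-b}{}_2F_1(c-a,c-b;c-a-b+1;1-z),\qquad R_{\mathcal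 B}=\beta R_{\rm slow}-\alpha R_{\rm fast},$$ $$F_{\alpha,\beta}(\omega)=\alpha\,\frac{\Gamma(c)\Gamma(c-a-b)}{\Gamma(c-a)\Gamma(c-b)}+\beta\,\frac{\Gamma(c)\Gamma(a+b-c)}{\Gamma(a)\Gamma(b)}$$ (with $1/\Gamma=0$ at the poles of $\Gamma$). With $W[u,v]=u\,\partial_zv-v\,\partial_zu$ and $W_{\rm sf}=W[R_{\rm slow},R_{\rm fast}]$, the Green's function is $$G(z,z';\omega)=\frac{R_{\rm in}(z_<;\omega)\,R_{\mathcal B}(z_>;\omega)}{w(z';\omega)\,W[R_{\rm in},R_{\mathcal B}](z';\omega)},\qquad z_<=\min(z,z'),\quad z_>=\max(z,z').$$ **Assumptions**, for all $\omega\in U$: - (A1) $a,b,c$ are analytic on $U$; - (A2) $c-a-b\notin\mathbb Z$; - (A3) $R_{\rm slow}(\cdot\,;\omega)$ and $R_{\rm fast}(\cdot\,;\omega)$ are linearly independent near the boundary $z=1$; - (A4) $w(z;\omega)W_{\rm sf}(z;\omega)\neq0$ for $0<z<1$. **Theorem 2 (Double-Pole Criterion).** Under these assumptions, let $z,z'\in(0,1)$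 be such that the leading numerator coefficient does not vanish: $R_{\rm in}(z_<;\omega_*)R_{\mathcal B}(z_>;\omega_*)\neq0$. Then $\omega\mapsto G(z,z';\omega)$ has a pole of exact order two at $\omega_*$ if and only if $$F_{\alpha,\beta}(\omega_*)=0,\qquad F'_{\alpha,\beta}(\omega_*)=0,\qquad F''_{\alpha,\beta}(\omega_*)\neq0 .$$ In that case there is a scalar $\chi_*\neq0$ with $R_{\mathcal B}(\cdot\,;\omega_*)=\chi_*R_{\rm in}(\cdot\,;\omega_*)$ on $(0,1)$, and, as $\omega\to\omega_*$, $$G(z,z';\omega)=-\frac{2}{(\omega-\omega_*)^2}\,\frac{\chi_*\,R_{\rm in}(z;\omega_*)R_{\rm in}(z';\omega_*)}{w(z';\omega_*)\,W_{\rm sf}(z';\omega_*)\,F''_{\alpha,\beta}(\omega_*)}+O\!\left(\frac1{\omega-\omega_*}\right).$$ -/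

import Mathlib

open Set Filter Topology Asymptotics

noncomputable section

/-- The Wronskian `u v' - v u'` of two functions of the real radial variable. -/
def radialWronskian (u v : ℝ → ℂ) (z : ℝ) : ℂ :=
  u z * deriv v z - v z * deriv u z

/-- The radial operator `Ψ'' + P Ψ' + Q Ψ`. -/
def radialOperator (P Q : ℝ → ℂ) (Ψ : ℝ → ℂ) (z : ℝ) : ℂ :=
  deriv (deriv Ψ) z + P z * deriv Ψ z + Q z * Ψ z

/-- The Gauss hypergeometric operator `z (1 - z) f'' + (c - (a + b + 1) z) f' - a b f`. -/
def gaussOperator (a b c : ℂ) (f : ℝ → ℂ) (z : ℝ) : ℂ :=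
  (z : ℂ) * (1 - (z : ℂ)) * deriv (deriv f) z
    + (c - (a + b + 1) * (z : ℂ)) * deriv f z - a * b * f z

/-- The data of a radial boundary value problem on `0 < z < 1` depending on a complex
frequency `ω`: the hypergeometric parameters `a, b, c`, the exponents `ρ₀, ρ₁` extracted at
`z = 0` and `z = 1`, the coefficients `P, Q` of the equation `Ψ'' + P Ψ' + Q Ψ = 0`, an indefinite
integral `intP` of `P` with respect to `z`, and the constants `α, β` of the boundary
functional `α c_slow + β c_fast` at `z = 1`. -/
structure RadialProblem where
  a : ℂ → ℂ
  b : ℂ → ℂ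
  c : ℂ → ℂ
  ρ₀ : ℂ → ℂ
  ρ₁ : ℂ → ℂ
  P : ℂ → ℝ → ℂ
  Q : ℂ → ℝ → ℂ
  intP : ℂ → ℝ → ℂ
  α : ℂ
  β : ℂ

namespace RadialProblem

variable (S : RadialProblem)

/-- The prefactor `z ^ ρ₀ (1 - z) ^ ρ₁` (principal powers of positive real numbers). -/
def prefactor (ω : ℂ) (z : ℝ) : ℂ :=
  (z : ℂ) ^ S.ρ₀ ω * (1 - (z : ℂ)) ^ S.ρ₁ ω

/-- The problem belongs to the hypergeometric spectral class for frequencies in `U`: the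
substitution `Ψ = z ^ ρ₀ (1 - z) ^ ρ₁ f` turns `Ψ'' + P Ψ' + Q Ψ` into the Gauss hypergeometric
operator applied to `f`, up to the nowhere zero factor `z ^ ρ₀ (1 - z) ^ ρ₁ / (z (1 - z))`.
(This forces `P` and `Q` to be rational in `z` with regular singular points at `0` and `1`, and
`ρ₀`, `ρ₁` to satisfy the indicial equations there.) -/
def IsHypergeometricOn (U : Set ℂ) : Prop :=
  ∀ ω ∈ U, ∀ f : ℝ → ℂ, ContDiffOn ℝ 2 f (Ioo 0 1) → ∀ z ∈ Ioo (0 : ℝ) 1,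
    (z : ℂ) * (1 - (z : ℂ)) *
        radialOperator (S.P ω) (S.Q ω) (fun t => S.prefactor ω t * f t) z
      = S.prefactor ω z * gaussOperator (S.a ω) (S.b ω) (S.c ω) f z

/-- `intP ω` is an indefinite integral of `P ω` on `0 < z < 1`, with an integration constant
depending analytically on `ω`. The analyticity clause holds trivially when
`P` and `intP` do not depend on `ω`. -/
def IsIndefiniteIntegralOn (U : Set ℂ) : Prop :=
  (∀ ω ∈ U, ∀ z ∈ Ioo (0 : ℝ) 1, HasDerivAt (S.intP ω) (S.P ω z) z) ∧
    ∀ z ∈ Ioo (0 : ℝ) 1, AnalyticOnNhd ℂ (fun ω => S.intP ω z) U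

/-- The Abel integrating factor `w = exp (∫ P dz)`. -/
def w (ω : ℂ) (z : ℝ) : ℂ := Complex.exp (S.intP ω z)

/-- The ingoing solution. -/
def Rin (ω : ℂ) (z : ℝ) : ℂ :=
  S.prefactor ω z * ordinaryHypergeometric (S.a ω) (S.b ω) (S.c ω) (z : ℂ)

/-- The slow solution at `z = 1`. -/
def Rslow (ω : ℂ) (z : ℝ) : ℂ :=
  S.prefactor ω z *
    ordinaryHypergeometric (S.a ω) (S.b ω) (S.a ω + S.b ω - S.c ω + 1) (1 - (z : ℂ))

/-- The fast solution at `z = 1`. -/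
def Rfast (ω : ℂ) (z : ℝ) : ℂ :=
  (z : ℂ) ^ S.ρ₀ ω * (1 - (z : ℂ)) ^ (S.ρ₁ ω + S.c ω - S.a ω - S.b ω) *
    ordinaryHypergeometric (S.c ω - S.a ω) (S.c ω - S.b ω) (S.c ω - S.a ω - S.b ω + 1)
      (1 - (z : ℂ))

/-- The solution adapted to the boundary condition at `z = 1`. -/
def RB (ω : ℂ) (z : ℝ) : ℂ := S.β * S.Rslow ω z - S.α * S.Rfast ω z

/-- The connection coefficient `C_slow`. Mathlib's `Complex.Gamma` is `0` at its poles, so that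
a quotient by it is `0` there, as `1 / Γ` is. -/
def Cslow (ω : ℂ) : ℂ :=
  Complex.Gamma (S.c ω) * Complex.Gamma (S.c ω - S.a ω - S.b ω) /
    (Complex.Gamma (S.c ω - S.a ω) * Complex.Gamma (S.c ω - S.b ω))

/-- The connection coefficient `C_fast`. -/
def Cfast (ω : ℂ) : ℂ :=
  Complex.Gamma (S.c ω) * Complex.Gamma (S.a ω + S.b ω - S.c ω) /
    (Complex.Gamma (S.a ω) * Complex.Gamma (S.b ω))

/-- The quantization function `F_{α,β}`. -/
def F (ω : ℂ) : ℂ := S.α * S.Cslow ω + S.β * S.Cfast ω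

/-- The Wronskian of the slow and the fast solution. -/
def Wsf (ω : ℂ) (z : ℝ) : ℂ := radialWronskian (S.Rslow ω) (S.Rfast ω) z

/-- The frequency-domain Green's function `G(z, z'; ω)`. -/
def G (z z' : ℝ) (ω : ℂ) : ℂ :=
  S.Rin ω (min z z') * S.RB ω (max z z') /
    (S.w ω z' * radialWronskian (S.Rin ω) (S.RB ω) z')

/-- A1: the hypergeometric parameters are analytic in the frequency. -/
def AssumptionA1 (U : Set ℂ) : Prop :=
  AnalyticOnNhd ℂ S.a U ∧ AnalyticOnNhd ℂ S.b U ∧ AnalyticOnNhd ℂ S.c U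

/-- A2: `c - a - b` is not an integer. -/
def AssumptionA2 (U : Set ℂ) : Prop :=
  ∀ ω ∈ U, ∀ n : ℤ, S.c ω - S.a ω - S.b ω ≠ n

/-- A3: the slow and the fast solution are linearly independent at the boundary `z = 1`, that is,
as germs of functions for `z → 1⁻`. -/
def AssumptionA3 (U : Set ℂ) : Prop :=
  ∀ ω ∈ U, ∀ k l : ℂ,
    (∀ᶠ z in 𝓝[<] (1 : ℝ), k * S.Rslow ω z + l * S.Rfast ω z = 0) → k = 0 ∧ l = 0

/-- A4: the Abel-weighted Wronskian of the slow and the fast solution does not vanish. -/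
def AssumptionA4 (U : Set ℂ) : Prop :=
  ∀ ω ∈ U, ∀ z ∈ Ioo (0 : ℝ) 1, S.w ω z * S.Wsf ω z ≠ 0

end RadialProblem

end

/-!
Put `d = c - a - b`. Everything rests on Gauss's connection formula, which gives
`Rin = Cslow Rslow + Cfast Rfast` on `(0, 1)`. The Wronskian is bilinear, so
`W[Rin, RB] = -(α Cslow + β Cfast) W[Rslow, Rfast] = -F Wsf`, and hence `G = h / F` near `ωs`, where
`h = -Rin RB / (w Wsf)` is analytic in `ω` and does not vanish at `ωs`. The poles of `G` are then
the zeros of `F`, with the same order, and the leading coefficient is `2 h(ωs) / F''(ωs)`. At a zero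
of `F` the vectors `(β, -α)` and `(Cslow, Cfast)` are proportional, so that `RB = χ Rin`.

*The connection formula* (`ordinaryHypergeometric_eq_slow_add_fast`). On the lens `|z| < 1`,
`|1 - z| < 1` the Wronskian of two solutions of the Gauss equation is a constant multiple of
`z ^ (-c) (1 - z) ^ (d - 1)`; for the slow and the fast solution the constant is `-d`, so these two
span the solutions and `₂F₁(a, b; c; z) = A slow + B fast`. If `Re d < 0`, then `B` is the limit of
`(1 - x) ^ (-d) ₂F₁(a, b; c; x)` as `x → 1⁻`. By Euler's limit for `Γ` the Taylor coefficients of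
`₂F₁(a, b; c; x)` are asymptotic to `Γ(c) Γ(-d) / (Γ(a) Γ(b))` times those of `(1 - x) ^ d`, and
an Abelian theorem turns this into the value of `B`. Differentiation
maps the parameters `a, b, c` to `a + 1, b + 1, c + 1` and `d` to `d - 1`, which settles `B` for all
`d` by induction (`fast_coefficient`). Euler's transformation, a consequence of the
uniqueness of the solution holomorphic at `0`, exchanges the slow and the fast solution and so
yields `A`.

*Analyticity in `ω`.* The hypergeometric function is analytic in its parameters by locally uniform
convergence. The exponents `ρ₀`, `ρ₁` are not assumed to be analytic; but the shape of the
equation forces `∫ P dz = (c - 2 ρ₀) log z - (d - 1 + 2 ρ₁) log (1 - z) + const`, and the values of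
this integral at three points recover `ρ₀` and `ρ₁` (`RadialProblem.analyticAt_exponents`).
-/

/-! ### The hypergeometric series and its differential equation -/

theorem ordinaryHypergeometricCoefficient_zero (a b c : ℂ) :
    ordinaryHypergeometricCoefficient a b c 0 = 1 := by
  simp [ordinaryHypergeometricCoefficient]

theorem ascPochhammer_eval_ne_zero {c : ℂ} (hc : ∀ n : ℕ, c ≠ -(n : ℂ)) (n : ℕ) :
    (ascPochhammer ℂ n).eval c ≠ 0 := by
  rw [Ne, ascPochhammer_eval_eq_zero_iff]
  rintro ⟨k, -, hk⟩
  exact hc k (by rw [hk, neg_neg])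

theorem ordinaryHypergeometricCoefficient_succ (a b : ℂ) {c : ℂ}
    (hc : ∀ n : ℕ, c ≠ -(n : ℂ)) (n : ℕ) :
    (n + 1) * (c + n) * ordinaryHypergeometricCoefficient a b c (n + 1) =
      (a + n) * (b + n) * ordinaryHypergeometricCoefficient a b c n := by
  have h1 := ascPochhammer_eval_ne_zero hc n
  have h2 : c + n ≠ 0 := fun h => hc n (eq_neg_of_add_eq_zero_left h)
  have h3 : (n : ℂ) + 1 ≠ 0 := by exact_mod_cast n.succ_ne_zero
  have h4 : (n.factorial : ℂ) ≠ 0 := by exact_mod_cast n.factorial_ne_zero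
  simp only [ordinaryHypergeometricCoefficient, ascPochhammer_succ_eval, Nat.factorial_succ]
  push_cast
  field_simp

theorem ascPochhammer_succ_eval_left (a : ℂ) (n : ℕ) :
    (ascPochhammer ℂ (n + 1)).eval a = a * (ascPochhammer ℂ n).eval (a + 1) := by
  simp [ascPochhammer_succ_left, Polynomial.eval_comp]

theorem ne_neg_natCast_add_one {c : ℂ} (hc : ∀ n : ℕ, c ≠ -(n : ℂ)) (n : ℕ) :
    c + 1 ≠ -(n : ℂ) := by
  intro h
  refine hc (n + 1) ?_
  push_cast
  linear_combination h

/-- Coefficient form of `₂F₁(a, b; c)' = (a b / c) ₂F₁(a + 1, b + 1; c + 1)`. -/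
theorem ordinaryHypergeometricCoefficient_succ_shift (a b : ℂ) {c : ℂ}
    (hc : ∀ n : ℕ, c ≠ -(n : ℂ)) (n : ℕ) :
    (n + 1) * ordinaryHypergeometricCoefficient a b c (n + 1) =
      a * b / c * ordinaryHypergeometricCoefficient (a + 1) (b + 1) (c + 1) n := by
  have h1 := ascPochhammer_eval_ne_zero (ne_neg_natCast_add_one hc) n
  have h2 : c ≠ 0 := by simpa using hc 0
  have h3 : (n : ℂ) + 1 ≠ 0 := by exact_mod_cast n.succ_ne_zero
  have h4 : (n.factorial : ℂ) ≠ 0 := by exact_mod_cast n.factorial_ne_zero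
  simp only [ordinaryHypergeometricCoefficient, ascPochhammer_succ_eval_left, Nat.factorial_succ]
  push_cast
  field_simp

theorem one_le_radius_ordinaryHypergeometricSeries (a b c : ℂ) :
    1 ≤ (ordinaryHypergeometricSeries ℂ a b c).radius := by
  by_cases h : ∀ k : ℕ, (k : ℂ) ≠ -a ∧ (k : ℂ) ≠ -b ∧ (k : ℂ) ≠ -c
  · exact (ordinaryHypergeometricSeries_radius_eq_one ℂ a b c h).ge
  · push Not at h
    obtain ⟨k, hk⟩ := h
    by_cases h1 : (k : ℂ) = -a
    · obtain rfl : a = -(k : ℂ) := by rw [h1, neg_neg]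
      simp [ordinaryHypergeometric_radius_top_of_neg_nat₁]
    by_cases h2 : (k : ℂ) = -b
    · obtain rfl : b = -(k : ℂ) := by rw [h2, neg_neg]
      simp [ordinaryHypergeometric_radius_top_of_neg_nat₂]
    · obtain rfl : c = -(k : ℂ) := by rw [hk h1 h2, neg_neg]
      simp [ordinaryHypergeometric_radius_top_of_neg_nat₃]

theorem hasFPowerSeriesOnBall_ordinaryHypergeometric (a b c : ℂ) :
    HasFPowerSeriesOnBall (₂F₁ a b c : ℂ → ℂ) (ordinaryHypergeometricSeries ℂ a b c) 0 1 :=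
  ((ordinaryHypergeometricSeries ℂ a b c).hasFPowerSeriesOnBall
    (one_pos.trans_le (one_le_radius_ordinaryHypergeometricSeries a b c))).mono one_pos
    (one_le_radius_ordinaryHypergeometricSeries a b c)

theorem eball_zero_one : Metric.eball (0 : ℂ) 1 = Metric.ball 0 1 := by
  simpa using Metric.eball_coe (x := (0 : ℂ)) (ε := 1)

theorem hasSum_ordinaryHypergeometric (a b c : ℂ) {z : ℂ} (hz : ‖z‖ < 1) :
    HasSum (fun n => ordinaryHypergeometricCoefficient a b c n * z ^ n) (₂F₁ a b c z) := by
  have h := (hasFPowerSeriesOnBall_ordinaryHypergeometric a b c).hasSum (y := z)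
    (by rw [eball_zero_one]; simpa using hz)
  rw [zero_add] at h
  simpa only [ordinaryHypergeometricSeries_apply_eq, smul_eq_mul] using h

theorem differentiableOn_ordinaryHypergeometric (a b c : ℂ) :
    DifferentiableOn ℂ (₂F₁ a b c : ℂ → ℂ) (Metric.ball 0 1) := by
  have h := (hasFPowerSeriesOnBall_ordinaryHypergeometric a b c).differentiableOn
  rwa [eball_zero_one] at h

theorem iteratedDeriv_ordinaryHypergeometric_zero (a b c : ℂ) (n : ℕ) :
    iteratedDeriv n (₂F₁ a b c : ℂ → ℂ) 0 =
      n.factorial * ordinaryHypergeometricCoefficient a b c n := by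
  have h := (hasFPowerSeriesOnBall_ordinaryHypergeometric a b c).factorial_smul 1 n
  rw [ordinaryHypergeometricSeries_apply_eq] at h
  rw [iteratedDeriv_eq_iteratedFDeriv, ← h]
  simp

theorem hasDerivAt_ordinaryHypergeometric (a b : ℂ) {c : ℂ} (hc : ∀ n : ℕ, c ≠ -(n : ℂ)) {z : ℂ}
    (hz : ‖z‖ < 1) :
    HasDerivAt (₂F₁ a b c : ℂ → ℂ) (a * b / c * ₂F₁ (a + 1) (b + 1) (c + 1) z) z := by
  have hb : z ∈ Metric.ball (0 : ℂ) 1 := by simpa using hz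
  have hd := differentiableOn_ordinaryHypergeometric a b c
  have h1 := Complex.hasSum_taylorSeries_on_ball (hd.deriv Metric.isOpen_ball) hb
  have h2 := (hasSum_ordinaryHypergeometric (a + 1) (b + 1) (c + 1) hz).mul_left (a * b / c)
  convert! (hd.differentiableAt (Metric.isOpen_ball.mem_nhds hb)).hasDerivAt using 1
  refine h2.unique ?_
  convert! h1 using 1
  ext n
  have h4 : (n.factorial : ℂ) ≠ 0 := by exact_mod_cast n.factorial_ne_zero
  rw [← mul_assoc, ← ordinaryHypergeometricCoefficient_succ_shift a b hc, ← iteratedDeriv_succ',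
    iteratedDeriv_ordinaryHypergeometric_zero, Nat.factorial_succ]
  simp only [smul_eq_mul, sub_zero]
  push_cast
  field_simp

/-- If `S` is the derivative of `∑ w n z ^ n`, then `z * S` is the sum of `n * w n * z ^ n`. -/
theorem hasSum_natCast_mul_mul_pow {w : ℕ → ℂ} {z S : ℂ}
    (h : HasSum (fun n : ℕ => (n + 1) * w (n + 1) * z ^ n) S) :
    HasSum (fun n : ℕ => n * w n * z ^ n) (z * S) := by
  rw [← hasSum_nat_add_iff' 1]
  simp only [Finset.range_one, Finset.sum_singleton, Nat.cast_zero, zero_mul, sub_zero]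
  convert! h.mul_left z using 2 with n
  push_cast
  ring

/-- The hypergeometric differential equation, with the derivatives of `₂F₁` written as
hypergeometric functions with shifted parameters. -/
theorem gauss_equation_ordinaryHypergeometric (a b : ℂ) {c : ℂ} (hc : ∀ n : ℕ, c ≠ -(n : ℂ))
    {z : ℂ} (hz : ‖z‖ < 1) :
    z * (1 - z) * (a * b / c * ((a + 1) * (b + 1) / (c + 1) *
        ₂F₁ (a + 1 + 1) (b + 1 + 1) (c + 1 + 1) z)) +
      (c - (a + b + 1) * z) * (a * b / c * ₂F₁ (a + 1) (b + 1) (c + 1) z)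
      - a * b * ₂F₁ a b c z = 0 := by
  set u := ordinaryHypergeometricCoefficient a b c
  have hc1 := ne_neg_natCast_add_one hc
  have h0 := hasSum_ordinaryHypergeometric a b c hz
  have h1 : HasSum (fun n : ℕ => (n + 1) * u (n + 1) * z ^ n)
      (a * b / c * ₂F₁ (a + 1) (b + 1) (c + 1) z) := by
    convert! (hasSum_ordinaryHypergeometric (a + 1) (b + 1) (c + 1) hz).mul_left (a * b / c)
      using 2 with n
    rw [ordinaryHypergeometricCoefficient_succ_shift a b hc, mul_assoc]
  have h2 : HasSum (fun n : ℕ => (n + 1) * ((↑(n + 1) + 1) * u (n + 1 + 1)) * z ^ n)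
      (a * b / c * ((a + 1) * (b + 1) / (c + 1) *
        ₂F₁ (a + 1 + 1) (b + 1 + 1) (c + 1 + 1) z)) := by
    convert! ((hasSum_ordinaryHypergeometric (a + 1 + 1) (b + 1 + 1) (c + 1 + 1) hz).mul_left
      ((a + 1) * (b + 1) / (c + 1))).mul_left (a * b / c) using 2 with n
    rw [ordinaryHypergeometricCoefficient_succ_shift a b hc,
      mul_left_comm, ordinaryHypergeometricCoefficient_succ_shift _ _ hc1]
    ring
  -- the series of `z F'`, `z F''` and `z ^ 2 F''`, in this order, where `F = ₂F₁(a, b; c)`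
  have h3 := hasSum_natCast_mul_mul_pow h1
  have h4 := hasSum_natCast_mul_mul_pow (w := fun n => (n + 1) * u (n + 1)) h2
  have h5 := hasSum_natCast_mul_mul_pow (w := fun n => (n - 1) * u n) (z := z)
    (S := z * (a * b / c * ((a + 1) * (b + 1) / (c + 1) *
        ₂F₁ (a + 1 + 1) (b + 1 + 1) (c + 1 + 1) z))) (by
      convert! h4 using 2 with n
      push_cast
      ring)
  have h := (((h4.sub h5).add (h1.mul_left c)).sub (h3.mul_left (a + b + 1))).sub
    (h0.mul_left (a * b))
  have hz0 := h.unique (hasSum_zero.congr_fun fun n => ?_)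
  · linear_combination hz0
  · have := ordinaryHypergeometricCoefficient_succ a b hc n
    simp only [u]
    linear_combination z ^ n * this

/-! ### Holomorphic solutions at the origin and Euler's transformation -/

/-- `f` is holomorphic on the (open) set `s` and solves there the Gauss hypergeometric equation
`z (1 - z) f'' + (c - (a + b + 1) z) f' - a b f = 0` in the complex variable `z`. -/
structure IsGaussSolutionOn (a b c : ℂ) (f : ℂ → ℂ) (s : Set ℂ) : Prop where
  differentiableOn : DifferentiableOn ℂ f s
  equation : ∀ z ∈ s, z * (1 - z) * deriv (deriv f) z + (c - (a + b + 1) * z) * deriv f z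
    - a * b * f z = 0

namespace IsGaussSolutionOn

variable {a b c : ℂ} {f g : ℂ → ℂ} {s t : Set ℂ}

theorem of_hasDerivAt {f' f'' : ℂ → ℂ} (hs : IsOpen s) (h1 : ∀ z ∈ s, HasDerivAt f (f' z) z)
    (h2 : ∀ z ∈ s, HasDerivAt f' (f'' z) z)
    (h : ∀ z ∈ s, z * (1 - z) * f'' z + (c - (a + b + 1) * z) * f' z - a * b * f z = 0) :
    IsGaussSolutionOn a b c f s := by
  refine ⟨fun z hz => (h1 z hz).differentiableAt.differentiableWithinAt, fun z hz => ?_⟩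
  have e : deriv f =ᶠ[𝓝 z] f' := by
    filter_upwards [hs.mem_nhds hz] with w hw using (h1 w hw).deriv
  rw [e.deriv_eq, (h2 z hz).deriv, (h1 z hz).deriv, h z hz]

theorem mono (h : IsGaussSolutionOn a b c f s) (hts : t ⊆ s) : IsGaussSolutionOn a b c f t :=
  ⟨h.differentiableOn.mono hts, fun z hz => h.equation z (hts hz)⟩

theorem hasDerivAt (h : IsGaussSolutionOn a b c f s) (hs : IsOpen s) {z : ℂ} (hz : z ∈ s) :
    HasDerivAt f (deriv f z) z :=
  (h.differentiableOn.differentiableAt (hs.mem_nhds hz)).hasDerivAt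

theorem hasDerivAt_deriv (h : IsGaussSolutionOn a b c f s) (hs : IsOpen s) {z : ℂ} (hz : z ∈ s) :
    HasDerivAt (deriv f) (deriv (deriv f) z) z :=
  ((h.differentiableOn.deriv hs).differentiableAt (hs.mem_nhds hz)).hasDerivAt

/-- The derivative of a solution solves the equation with all parameters raised by `1`. -/
theorem deriv_shift (h : IsGaussSolutionOn a b c f s) (hs : IsOpen s) :
    IsGaussSolutionOn (a + 1) (b + 1) (c + 1) (deriv f) s := by
  refine ⟨h.differentiableOn.deriv hs, fun z hz => ?_⟩
  have h0 := h.hasDerivAt hs hz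
  have h1 := h.hasDerivAt_deriv hs hz
  have h2 := (((h.differentiableOn.deriv hs).deriv hs).differentiableAt
    (hs.mem_nhds hz)).hasDerivAt
  have hE := ((((hasDerivAt_id z).mul ((hasDerivAt_id z).const_sub 1)).mul h2).add
    ((((hasDerivAt_id z).const_mul (a + b + 1)).const_sub c).mul h1)).sub (h0.const_mul (a * b))
  have hzero := hE.congr_of_eventuallyEq (f₁ := fun _ => 0) (by
    filter_upwards [hs.mem_nhds hz] with w hw
    simpa using (h.equation w hw).symm)
  have := hzero.unique (hasDerivAt_const z 0)
  simp only [Pi.mul_apply, id] at this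
  linear_combination this

theorem iteratedDeriv_zero (hc : ∀ n : ℕ, c ≠ -(n : ℂ)) (hs : IsOpen s) (h0 : (0 : ℂ) ∈ s)
    (h : IsGaussSolutionOn a b c f s) (n : ℕ) :
    iteratedDeriv n f 0 = n.factorial * ordinaryHypergeometricCoefficient a b c n * f 0 := by
  induction n generalizing a b c f with
  | zero => simp [ordinaryHypergeometricCoefficient_zero]
  | succ n ih =>
    have hc0 : c ≠ 0 := by simpa using hc 0
    have he : c * deriv f 0 = a * b * f 0 := by
      have := h.equation 0 h0
      simp only [zero_mul, mul_zero, sub_zero, zero_add] at this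
      linear_combination this
    rw [iteratedDeriv_succ', ih (ne_neg_natCast_add_one hc) (h.deriv_shift hs), Nat.factorial_succ]
    have := ordinaryHypergeometricCoefficient_succ_shift a b hc n
    have he' : deriv f 0 = a * b / c * f 0 := by field_simp; linear_combination he
    rw [he']
    push_cast
    linear_combination -(n.factorial : ℂ) * f 0 * this

/-- A solution of the Gauss equation that is holomorphic on the unit disc is a multiple of
`₂F₁`: differentiating the equation `n` times determines the `n`-th Taylor coefficient. -/
theorem eq_mul_ordinaryHypergeometric (hc : ∀ n : ℕ, c ≠ -(n : ℂ))
    (h : IsGaussSolutionOn a b c f (Metric.ball 0 1)) {z : ℂ} (hz : ‖z‖ < 1) :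
    f z = f 0 * ₂F₁ a b c z := by
  have hb : z ∈ Metric.ball (0 : ℂ) 1 := by simpa using hz
  refine (Complex.hasSum_taylorSeries_on_ball h.differentiableOn hb).unique ?_
  convert! (hasSum_ordinaryHypergeometric a b c hz).mul_left (f 0) using 2 with n
  have h4 : (n.factorial : ℂ) ≠ 0 := by exact_mod_cast n.factorial_ne_zero
  rw [h.iteratedDeriv_zero hc Metric.isOpen_ball (by simp)]
  simp only [smul_eq_mul, sub_zero]
  field_simp

end IsGaussSolutionOn

theorem isGaussSolutionOn_ordinaryHypergeometric (a b : ℂ) {c : ℂ}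
    (hc : ∀ n : ℕ, c ≠ -(n : ℂ)) :
    IsGaussSolutionOn a b c (₂F₁ a b c) (Metric.ball 0 1) :=
  .of_hasDerivAt Metric.isOpen_ball
    (fun _ hz => hasDerivAt_ordinaryHypergeometric a b hc (by simpa using hz))
    (fun _ hz => (hasDerivAt_ordinaryHypergeometric (a + 1) (b + 1)
      (ne_neg_natCast_add_one hc) (by simpa using hz)).const_mul _)
    (fun _ hz => gauss_equation_ordinaryHypergeometric a b hc (by simpa using hz))

theorem one_sub_mem_slitPlane {z : ℂ} (hz : ‖z‖ < 1) : 1 - z ∈ Complex.slitPlane := by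
  refine Or.inl ?_
  have := (Complex.re_le_norm z).trans_lt hz
  simp only [Complex.sub_re, Complex.one_re]
  linarith

theorem hasDerivAt_one_sub_cpow (s : ℂ) {z : ℂ} (hz : 1 - z ∈ Complex.slitPlane) :
    HasDerivAt (fun w : ℂ => (1 - w) ^ s) (-s * (1 - z) ^ (s - 1)) z := by
  convert! ((hasDerivAt_id z).const_sub 1).cpow_const (c := s) hz using 1
  simp

theorem cpow_sub_one_eq_div {x : ℂ} (hx : x ≠ 0) (s : ℂ) : x ^ (s - 1) = x ^ s / x := by
  rw [Complex.cpow_sub _ _ hx, Complex.cpow_one]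

/-- Multiplication by `(1 - z) ^ (c - a - b)` carries solutions of the Gauss equation with parameters
`c - a, c - b, c` to solutions with parameters `a, b, c`. -/
theorem IsGaussSolutionOn.one_sub_cpow_mul {a b c : ℂ} {h : ℂ → ℂ} {s : Set ℂ} (hs : IsOpen s)
    (hslit : ∀ z ∈ s, 1 - z ∈ Complex.slitPlane)
    (hh : IsGaussSolutionOn (c - a) (c - b) c h s) :
    IsGaussSolutionOn a b c (fun z => (1 - z) ^ (c - a - b) * h z) s := by
  refine .of_hasDerivAt hs
    (fun z hz => (hasDerivAt_one_sub_cpow _ (hslit z hz)).mul (hh.hasDerivAt hs hz))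
    (fun z hz => (((hasDerivAt_one_sub_cpow _ (hslit z hz)).const_mul _).mul
      (hh.hasDerivAt hs hz)).add ((hasDerivAt_one_sub_cpow _ (hslit z hz)).mul
      (hh.hasDerivAt_deriv hs hz))) fun z hz => ?_
  have hx : (1 - z) ≠ 0 := Complex.slitPlane_ne_zero (hslit z hz)
  have e := hh.equation z hz
  simp only [cpow_sub_one_eq_div hx]
  generalize (1 - z) ^ (c - a - b) = p
  field_simp
  linear_combination p * (1 - z) * e

/-- Euler's transformation. -/
theorem ordinaryHypergeometric_eq_one_sub_cpow_mul (a b : ℂ) {c : ℂ} (hc : ∀ n : ℕ, c ≠ -(n : ℂ))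
    {z : ℂ} (hz : ‖z‖ < 1) :
    ₂F₁ a b c z = (1 - z) ^ (c - a - b) * ₂F₁ (c - a) (c - b) c z := by
  have h := (isGaussSolutionOn_ordinaryHypergeometric (c - a) (c - b) hc).one_sub_cpow_mul
    (a := a) (b := b) Metric.isOpen_ball (fun z hz => one_sub_mem_slitPlane (by simpa using hz))
  have := h.eq_mul_ordinaryHypergeometric hc hz
  simp only [sub_zero, Complex.one_cpow, ordinaryHypergeometric_zero, mul_one, one_mul] at this
  exact this.symm

theorem ordinaryHypergeometric_zero_right (a : ℂ) {c : ℂ} (hc : ∀ n : ℕ, c ≠ -(n : ℂ)) {z : ℂ}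
    (hz : ‖z‖ < 1) : ₂F₁ a 0 c z = 1 := by
  have h : IsGaussSolutionOn a 0 c (fun _ => 1) (Metric.ball 0 1) :=
    .of_hasDerivAt Metric.isOpen_ball (fun z _ => hasDerivAt_const z 1)
      (fun z _ => hasDerivAt_const z 0) (by simp)
  simpa using (h.eq_mul_ordinaryHypergeometric hc hz).symm

theorem ordinaryHypergeometric_zero_left (b : ℂ) {c : ℂ} (hc : ∀ n : ℕ, c ≠ -(n : ℂ)) {z : ℂ}
    (hz : ‖z‖ < 1) : ₂F₁ 0 b c z = 1 := by
  have h : IsGaussSolutionOn 0 b c (fun _ => 1) (Metric.ball 0 1) :=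
    .of_hasDerivAt Metric.isOpen_ball (fun z _ => hasDerivAt_const z 1)
      (fun z _ => hasDerivAt_const z 0) (by simp)
  simpa using (h.eq_mul_ordinaryHypergeometric hc hz).symm

theorem one_ne_neg_natCast (n : ℕ) : (1 : ℂ) ≠ -(n : ℂ) := fun h => by
  have := congrArg Complex.re h
  simp only [Complex.one_re, Complex.neg_re, Complex.natCast_re] at this
  linarith [(n.cast_nonneg : (0 : ℝ) ≤ n)]

/-- The binomial series, as the case of Euler's transformation in which the right-hand series
reduces to `1`. -/
theorem one_sub_cpow_neg_eq_ordinaryHypergeometric (s : ℂ) {z : ℂ} (hz : ‖z‖ < 1) :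
    (1 - z) ^ (-s) = ₂F₁ s 1 1 z := by
  rw [ordinaryHypergeometric_eq_one_sub_cpow_mul s 1 one_ne_neg_natCast hz, sub_self,
    ordinaryHypergeometric_zero_right _ one_ne_neg_natCast hz, mul_one]
  ring_nf

/-! ### The slow and the fast solution of the Gauss equation -/

/-- The lens `|z| < 1`, `|1 - z| < 1`, on which the local solutions of the Gauss equation at `0`
and at `1` are all holomorphic. -/
def lens : Set ℂ := Metric.ball 0 1 ∩ Metric.ball 1 1

theorem isOpen_lens : IsOpen lens := Metric.isOpen_ball.inter Metric.isOpen_ball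

theorem isPreconnected_lens : IsPreconnected lens :=
  ((convex_ball _ _).inter (convex_ball _ _)).isPreconnected

theorem mem_lens {z : ℂ} : z ∈ lens ↔ ‖z‖ < 1 ∧ ‖1 - z‖ < 1 := by
  simp [lens, dist_eq_norm, norm_sub_rev]

theorem slitPlane_of_mem_lens {z : ℂ} (hz : z ∈ lens) : z ∈ Complex.slitPlane := by
  simpa using one_sub_mem_slitPlane (mem_lens.1 hz).2

theorem one_sub_slitPlane_of_mem_lens {z : ℂ} (hz : z ∈ lens) : 1 - z ∈ Complex.slitPlane :=
  one_sub_mem_slitPlane (mem_lens.1 hz).1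

theorem ofReal_mem_lens {t : ℝ} (ht : t ∈ Ioo (0 : ℝ) 1) : (t : ℂ) ∈ lens := by
  rw [mem_lens, ← Complex.ofReal_one, ← Complex.ofReal_sub, Complex.norm_real, Complex.norm_real,
    Real.norm_eq_abs, Real.norm_eq_abs, abs_lt, abs_lt]
  constructor <;> constructor <;> linarith [ht.1, ht.2]

/-- The Abel formula for the Gauss equation: the Wronskian of two solutions is a constant multiple
of `z ^ (-c) (1 - z) ^ (c - a - b - 1)`. -/
theorem IsGaussSolutionOn.exists_wronskian_eq {a b c : ℂ} {f g : ℂ → ℂ}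
    (hf : IsGaussSolutionOn a b c f lens) (hg : IsGaussSolutionOn a b c g lens) :
    ∃ K : ℂ, ∀ z ∈ lens, f z * deriv g z - g z * deriv f z =
      K * (z ^ (-c) * (1 - z) ^ (c - a - b - 1)) := by
  have key : ∀ z ∈ lens, HasDerivAt
      (fun z : ℂ => z ^ c * (1 - z) ^ (1 + a + b - c) * (f z * deriv g z - g z * deriv f z)) 0 z := by
    intro z hz
    have hz0 := Complex.slitPlane_ne_zero (slitPlane_of_mem_lens hz)
    have hz1 := Complex.slitPlane_ne_zero (one_sub_slitPlane_of_mem_lens hz)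
    have hd := (((hasDerivAt_id z).cpow_const (c := c) (slitPlane_of_mem_lens hz)).mul
      (hasDerivAt_one_sub_cpow (1 + a + b - c) (one_sub_slitPlane_of_mem_lens hz))).mul
      (((hf.hasDerivAt isOpen_lens hz).mul (hg.hasDerivAt_deriv isOpen_lens hz)).sub
        ((hg.hasDerivAt isOpen_lens hz).mul (hf.hasDerivAt_deriv isOpen_lens hz)))
    refine hd.congr_deriv ?_
    have ef := hf.equation z hz
    have eg := hg.equation z hz
    simp only [id, Pi.mul_apply, Pi.sub_apply, cpow_sub_one_eq_div hz0, cpow_sub_one_eq_div hz1]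
    generalize z ^ c = p
    generalize (1 - z) ^ (1 + a + b - c) = q
    field_simp
    linear_combination p * q * f z * eg - p * q * g z * ef
  obtain ⟨K, hK⟩ := isOpen_lens.exists_is_const_of_deriv_eq_zero isPreconnected_lens
    (fun z hz => (key z hz).differentiableAt.differentiableWithinAt) (fun z hz => (key z hz).deriv)
  refine ⟨K, fun z hz => ?_⟩
  have hz0 := Complex.slitPlane_ne_zero (slitPlane_of_mem_lens hz)
  have hz1 := Complex.slitPlane_ne_zero (one_sub_slitPlane_of_mem_lens hz)
  have h0 : z ^ c ≠ 0 := by simp [Complex.cpow_eq_zero_iff, hz0]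
  have h1 : (1 - z) ^ (1 + a + b - c) ≠ 0 := by simp [Complex.cpow_eq_zero_iff, hz1]
  rw [← hK z hz, Complex.cpow_neg, show c - a - b - 1 = -(1 + a + b - c) by ring, Complex.cpow_neg]
  field_simp

/-- The solution of the Gauss equation that is holomorphic at `z = 1`, with value `1` there. -/
noncomputable def gaussSlow (a b c z : ℂ) : ℂ := ₂F₁ a b (a + b - c + 1) (1 - z)

/-- The solution of the Gauss equation with exponent `c - a - b` at `z = 1`. -/
noncomputable def gaussFast (a b c z : ℂ) : ℂ :=
  (1 - z) ^ (c - a - b) * ₂F₁ (c - a) (c - b) (c - a - b + 1) (1 - z)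

section

variable {a b c : ℂ}

theorem slow_param_ne (hd : ∀ n : ℤ, c - a - b ≠ n) (n : ℕ) : a + b - c + 1 ≠ -(n : ℂ) := by
  intro h
  refine hd (n + 1) ?_
  push_cast
  linear_combination -h

theorem fast_param_ne (hd : ∀ n : ℤ, c - a - b ≠ n) (n : ℕ) : c - a - b + 1 ≠ -(n : ℂ) := by
  intro h
  refine hd (-n - 1) ?_
  push_cast
  linear_combination h

/-- The reflection `z ↦ 1 - z` replaces `c` by `a + b - c + 1`. -/
theorem IsGaussSolutionOn.comp_one_sub {a b c : ℂ} {h : ℂ → ℂ}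
    (hh : IsGaussSolutionOn a b (a + b - c + 1) h (Metric.ball 0 1)) :
    IsGaussSolutionOn a b c (fun z => h (1 - z)) lens := by
  have hb : ∀ z ∈ lens, 1 - z ∈ Metric.ball (0 : ℂ) 1 := fun z hz => by
    simpa using (mem_lens.1 hz).2
  refine .of_hasDerivAt (f' := fun z => -deriv h (1 - z)) (f'' := fun z => deriv (deriv h) (1 - z))
    isOpen_lens (fun z hz => ?_) (fun z hz => ?_) fun z hz => ?_
  · exact (hh.hasDerivAt Metric.isOpen_ball (hb z hz)).comp_const_sub 1 z
  · convert! ((hh.hasDerivAt_deriv Metric.isOpen_ball (hb z hz)).comp_const_sub 1 z).neg using 1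
    simp
  · linear_combination hh.equation _ (hb z hz)

theorem isGaussSolutionOn_gaussSlow (hd : ∀ n : ℤ, c - a - b ≠ n) :
    IsGaussSolutionOn a b c (gaussSlow a b c) lens :=
  (isGaussSolutionOn_ordinaryHypergeometric a b (slow_param_ne hd)).comp_one_sub

theorem isGaussSolutionOn_gaussFast (hd : ∀ n : ℤ, c - a - b ≠ n) :
    IsGaussSolutionOn a b c (gaussFast a b c) lens := by
  have h := isGaussSolutionOn_ordinaryHypergeometric (c - a) (c - b) (fast_param_ne hd)
  rw [show c - a - b + 1 = (c - a) + (c - b) - c + 1 by ring] at h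
  have h2 := h.comp_one_sub.one_sub_cpow_mul (a := a) (b := b) isOpen_lens
    fun z hz => one_sub_slitPlane_of_mem_lens hz
  rw [show (c - a) + (c - b) - c + 1 = c - a - b + 1 by ring] at h2
  exact h2

theorem gaussSlow_hasDerivAt (hd : ∀ n : ℤ, c - a - b ≠ n) {z : ℂ} (hz : z ∈ lens) :
    HasDerivAt (gaussSlow a b c)
      (-(a * b / (a + b - c + 1)) * gaussSlow (a + 1) (b + 1) (c + 1) z) z := by
  have h := (hasDerivAt_ordinaryHypergeometric a b (slow_param_ne hd)
    (mem_lens.1 hz).2).comp_const_sub 1 z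
  convert! h using 1
  rw [gaussSlow, show a + 1 + (b + 1) - (c + 1) + 1 = a + b - c + 1 + 1 by ring, neg_mul]

/-- `d · ₂F₁(p, q; d + 1; x) + x · ₂F₁(p, q; d + 1; x)' = d · ₂F₁(p, q; d; x)`. -/
theorem ordinaryHypergeometric_lower_third (p q : ℂ) {d : ℂ} (hd : ∀ n : ℕ, d ≠ -(n : ℂ)) {x : ℂ}
    (hx : ‖x‖ < 1) :
    d * ₂F₁ p q (d + 1) x + x * deriv (₂F₁ p q (d + 1)) x = d * ₂F₁ p q d x := by
  have hd1 := ne_neg_natCast_add_one hd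
  have h0 := hasSum_ordinaryHypergeometric p q (d + 1) hx
  have h1 : HasSum (fun n : ℕ => (n + 1) * ordinaryHypergeometricCoefficient p q (d + 1) (n + 1)
      * x ^ n) (deriv (₂F₁ p q (d + 1)) x) := by
    rw [(hasDerivAt_ordinaryHypergeometric p q hd1 hx).deriv]
    convert! (hasSum_ordinaryHypergeometric (p + 1) (q + 1) (d + 1 + 1) hx).mul_left
      (p * q / (d + 1)) using 2 with n
    rw [ordinaryHypergeometricCoefficient_succ_shift p q hd1, mul_assoc]
  refine ((h0.mul_left d).add (hasSum_natCast_mul_mul_pow h1)).unique ?_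
  convert! (hasSum_ordinaryHypergeometric p q d hx).mul_left d using 2 with n
  have e : d * (ascPochhammer ℂ n).eval (d + 1) = (ascPochhammer ℂ n).eval d * (d + n) := by
    rw [← ascPochhammer_succ_eval_left, ascPochhammer_succ_eval]
  have n0 := ascPochhammer_eval_ne_zero hd n
  have n1 := ascPochhammer_eval_ne_zero hd1 n
  have n2 : (n.factorial : ℂ) ≠ 0 := by exact_mod_cast n.factorial_ne_zero
  simp only [ordinaryHypergeometricCoefficient]
  field_simp
  linear_combination -(ascPochhammer ℂ n).eval p * (ascPochhammer ℂ n).eval q * x ^ n * e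

theorem gaussFast_hasDerivAt (hd : ∀ n : ℤ, c - a - b ≠ n) {z : ℂ} (hz : z ∈ lens) :
    HasDerivAt (gaussFast a b c) (-(c - a - b) * gaussFast (a + 1) (b + 1) (c + 1) z) z := by
  have hd' : ∀ n : ℕ, c - a - b ≠ -(n : ℂ) := fun n h => hd (-n) (by push_cast; exact h)
  have hx := (mem_lens.1 hz).2
  have hx0 := Complex.slitPlane_ne_zero (one_sub_slitPlane_of_mem_lens hz)
  have h := (hasDerivAt_one_sub_cpow (c - a - b) (one_sub_slitPlane_of_mem_lens hz)).mul
    ((hasDerivAt_ordinaryHypergeometric (c - a) (c - b) (fast_param_ne hd)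
      hx).differentiableAt.hasDerivAt.comp_const_sub 1 z)
  refine h.congr_deriv ?_
  have e := ordinaryHypergeometric_lower_third (c - a) (c - b) hd' hx
  rw [gaussFast, show c + 1 - (a + 1) - (b + 1) = c - a - b - 1 by ring,
    show c + 1 - (a + 1) = c - a by ring, show c + 1 - (b + 1) = c - b by ring, sub_add_cancel,
    cpow_sub_one_eq_div hx0]
  field_simp
  linear_combination -(1 - z) ^ (c - a - b) * e

theorem tendsto_one_sub_ofReal :
    Tendsto (fun x : ℝ => 1 - (x : ℂ)) (𝓝[<] 1) (𝓝 0) := by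
  have : Tendsto (fun x : ℝ => 1 - (x : ℂ)) (𝓝 1) (𝓝 (1 - ((1 : ℝ) : ℂ))) :=
    (continuous_const.sub Complex.continuous_ofReal : Continuous fun x : ℝ => (1 : ℂ) - x).tendsto 1
  simpa using this.mono_left nhdsWithin_le_nhds

theorem tendsto_ordinaryHypergeometric_one_sub (a b c : ℂ) :
    Tendsto (fun x : ℝ => ₂F₁ a b c (1 - (x : ℂ))) (𝓝[<] 1) (𝓝 1) := by
  have h := ((differentiableOn_ordinaryHypergeometric a b c).differentiableAt
    (Metric.isOpen_ball.mem_nhds (by simp : (0 : ℂ) ∈ Metric.ball 0 1))).continuousAt.tendsto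
  rw [ordinaryHypergeometric_zero] at h
  exact h.comp tendsto_one_sub_ofReal

theorem eventually_mem_Ioo_zero_one : ∀ᶠ x : ℝ in 𝓝[<] 1, x ∈ Ioo (0 : ℝ) 1 :=
  Ioo_mem_nhdsLT one_pos

/-- The constant in the Abel formula for the slow and the fast solution is `-(c - a - b)`. -/
theorem wronskian_gaussSlow_gaussFast (hd : ∀ n : ℤ, c - a - b ≠ n) {z : ℂ} (hz : z ∈ lens) :
    gaussSlow a b c z * deriv (gaussFast a b c) z - gaussFast a b c z * deriv (gaussSlow a b c) z =
      -(c - a - b) * (z ^ (-c) * (1 - z) ^ (c - a - b - 1)) := by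
  obtain ⟨K, hK⟩ := (isGaussSolutionOn_gaussSlow hd).exists_wronskian_eq
    (isGaussSolutionOn_gaussFast hd)
  rw [hK z hz]
  congr 1
  -- the Wronskian, divided by `(1 - x) ^ (c - a - b - 1)`, has the limits `K` and `-(c - a - b)`
  have h1 : Tendsto (fun x : ℝ => K * (x : ℂ) ^ (-c)) (𝓝[<] 1) (𝓝 (K * 1)) := by
    have : ContinuousAt (fun x : ℂ => x ^ (-c)) ((1 : ℝ) : ℂ) :=
      continuousAt_cpow_const (by simp)
    have h := (this.comp (f := fun x : ℝ => (x : ℂ)) Complex.continuous_ofReal.continuousAt).tendsto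
    simp only [Function.comp_def, Complex.ofReal_one, Complex.one_cpow] at h
    exact (h.mono_left nhdsWithin_le_nhds).const_mul K
  have h2 : Tendsto (fun x : ℝ =>
      ₂F₁ a b (a + b - c + 1) (1 - (x : ℂ)) * (-(c - a - b) *
        ₂F₁ (c - a) (c - b) (c - a - b) (1 - (x : ℂ))) -
      (1 - (x : ℂ)) * (₂F₁ (c - a) (c - b) (c - a - b + 1) (1 - (x : ℂ)) *
        (-(a * b / (a + b - c + 1)) * ₂F₁ (a + 1) (b + 1) (a + b - c + 1 + 1) (1 - (x : ℂ)))))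
      (𝓝[<] 1) (𝓝 (1 * (-(c - a - b) * 1) - 0 * (1 * (-(a * b / (a + b - c + 1)) * 1)))) :=
    ((tendsto_ordinaryHypergeometric_one_sub _ _ _).mul
      ((tendsto_ordinaryHypergeometric_one_sub _ _ _).const_mul _)).sub
      (tendsto_one_sub_ofReal.mul ((tendsto_ordinaryHypergeometric_one_sub _ _ _).mul
      ((tendsto_ordinaryHypergeometric_one_sub _ _ _).const_mul _)))
  have h3 := tendsto_nhds_unique_of_eventuallyEq h1 h2 ?_
  · simpa using h3
  filter_upwards [eventually_mem_Ioo_zero_one] with x hx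
  have hl := ofReal_mem_lens hx
  have hx0 := Complex.slitPlane_ne_zero (one_sub_slitPlane_of_mem_lens hl)
  have hW := hK x hl
  rw [(gaussFast_hasDerivAt hd hl).deriv, (gaussSlow_hasDerivAt hd hl).deriv] at hW
  simp only [gaussFast, gaussSlow] at hW
  rw [show c + 1 - (a + 1) - (b + 1) = c - a - b - 1 by ring,
    show c + 1 - (a + 1) = c - a by ring, show c + 1 - (b + 1) = c - b by ring, sub_add_cancel,
    show a + 1 + (b + 1) - (c + 1) + 1 = a + b - c + 1 + 1 by ring, cpow_sub_one_eq_div hx0] at hW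
  have hp : (1 - (x : ℂ)) ^ (c - a - b) ≠ 0 := by simp [Complex.cpow_eq_zero_iff, hx0]
  refine mul_left_cancel₀ (div_ne_zero hp hx0) ?_
  rw [← mul_assoc, mul_comm _ K, mul_assoc, mul_comm (_ / _), ← hW]
  field_simp

/-- Every solution of the Gauss equation is a combination of the slow and the fast one. -/
theorem IsGaussSolutionOn.exists_eq_slow_add_fast (hd : ∀ n : ℤ, c - a - b ≠ n) {f : ℂ → ℂ}
    (hf : IsGaussSolutionOn a b c f lens) :
    ∃ A B : ℂ, ∀ z ∈ lens, f z = A * gaussSlow a b c z + B * gaussFast a b c z := by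
  obtain ⟨K₁, h₁⟩ := hf.exists_wronskian_eq (isGaussSolutionOn_gaussFast hd)
  obtain ⟨K₂, h₂⟩ := hf.exists_wronskian_eq (isGaussSolutionOn_gaussSlow hd)
  have hd0 : c - a - b ≠ 0 := by simpa using hd 0
  refine ⟨-K₁ / (c - a - b), K₂ / (c - a - b), fun z hz => ?_⟩
  have hz0 := Complex.slitPlane_ne_zero (slitPlane_of_mem_lens hz)
  have hz1 := Complex.slitPlane_ne_zero (one_sub_slitPlane_of_mem_lens hz)
  -- Cramer's rule for `f` and `f'`, multiplied by the Wronskian of the two solutions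
  have hW := wronskian_gaussSlow_gaussFast hd hz
  have hp : z ^ (-c) * (1 - z) ^ (c - a - b - 1) ≠ 0 :=
    mul_ne_zero (by simp [Complex.cpow_eq_zero_iff, hz0])
      (by simp [Complex.cpow_eq_zero_iff, hz1])
  have e₁ := h₁ z hz
  have e₂ := h₂ z hz
  refine mul_left_cancel₀ (mul_ne_zero hd0 hp) ?_
  field_simp
  linear_combination f z * hW - gaussSlow a b c z * e₁ + gaussFast a b c z * e₂

end

/-! ### Asymptotics of the hypergeometric function at `z = 1` -/

/-- An Abelian theorem: if `u n = o(r n)` with `r n ≥ 0` and `∑ r n x ^ n` tends to infinity as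
`x → 1⁻`, then `∑ u n x ^ n = o(∑ r n x ^ n)`. -/
theorem tsum_mul_pow_isLittleO {u : ℕ → ℂ} {r : ℕ → ℝ} (hr : ∀ n, 0 ≤ r n)
    (hs : ∀ x ∈ Ioo (0 : ℝ) 1, Summable fun n => r n * x ^ n) (hur : u =o[atTop] r)
    (hlim : Tendsto (fun x : ℝ => ∑' n, r n * x ^ n) (𝓝[<] 1) atTop) :
    (fun x : ℝ => ∑' n, u n * (x : ℂ) ^ n) =o[𝓝[<] 1] fun x : ℝ => ∑' n, r n * x ^ n := by
  rw [isLittleO_iff]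
  intro ε hε
  obtain ⟨N, hN⟩ := eventually_atTop.1 (isLittleO_iff.1 hur (half_pos hε))
  set C : ℝ := ∑ n ∈ Finset.range N, ‖u n‖
  filter_upwards [eventually_mem_Ioo_zero_one, hlim.eventually_ge_atTop (2 * C / ε)] with x hx hR
  have hx0 := hx.1.le
  have hpow : ∀ n, 0 ≤ x ^ n := fun n => pow_nonneg hx0 n
  have hb : ∀ n, ‖u n * (x : ℂ) ^ n‖ ≤
      (if n < N then ‖u n‖ else 0) + ε / 2 * (r n * x ^ n) := by
    intro n
    rw [norm_mul, norm_pow, Complex.norm_real, Real.norm_of_nonneg hx0]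
    split_ifs with h
    · have h1 : ‖u n‖ * x ^ n ≤ ‖u n‖ :=
        mul_le_of_le_one_right (norm_nonneg _) (pow_le_one₀ hx0 hx.2.le)
      have h2 := mul_nonneg (half_pos hε).le (mul_nonneg (hr n) (hpow n))
      linarith
    · have h1 := hN n (not_lt.1 h)
      rw [Real.norm_of_nonneg (hr n)] at h1
      calc _ ≤ ε / 2 * r n * x ^ n := mul_le_mul_of_nonneg_right h1 (hpow n)
        _ = _ := by ring
  have hfin : HasSum (fun n => if n < N then ‖u n‖ else 0) C := by
    have h : HasSum (fun n => if n < N then ‖u n‖ else 0)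
        (∑ n ∈ Finset.range N, if n < N then ‖u n‖ else 0) :=
      hasSum_sum_of_ne_finset_zero fun n hn => if_neg (by simpa using hn)
    convert h using 1
    exact Finset.sum_congr rfl fun n hn => by simp [Finset.mem_range.1 hn]
  have hR0 : 0 ≤ ∑' n, r n * x ^ n := tsum_nonneg fun n => mul_nonneg (hr n) (hpow n)
  have h := tsum_of_norm_bounded (hfin.add ((hs x hx).hasSum.mul_left (ε / 2))) hb
  rw [Real.norm_of_nonneg hR0]
  rw [div_le_iff₀ hε] at hR
  linarith

theorem prod_range_add_eq_ascPochhammer (s : ℂ) (n : ℕ) :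
    ∏ j ∈ Finset.range n, (s + j) = (ascPochhammer ℂ n).eval s := by
  induction n with
  | zero => simp
  | succ n ih => rw [Finset.prod_range_succ, ih, ascPochhammer_succ_eval]

/-- Euler's limit for `1 / Γ`. It includes the poles of `Γ`, where the limit is `0` and the sequence
is eventually `0`. -/
theorem tendsto_ascPochhammer_div (s : ℂ) :
    Tendsto (fun n : ℕ => (ascPochhammer ℂ (n + 1)).eval s / ((n : ℂ) ^ s * n.factorial)) atTop
      (𝓝 (Complex.Gamma s)⁻¹) := by
  have e : (fun n : ℕ => (ascPochhammer ℂ (n + 1)).eval s / ((n : ℂ) ^ s * n.factorial)) =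
      fun n => (Complex.GammaSeq s n)⁻¹ := by
    ext n
    rw [Complex.GammaSeq, inv_div, prod_range_add_eq_ascPochhammer]
  rw [e]
  by_cases h : Complex.Gamma s = 0
  · obtain ⟨m, hm⟩ := Complex.Gamma_eq_zero_iff s |>.1 h
    rw [h, inv_zero]
    refine tendsto_const_nhds.congr' ?_
    filter_upwards [eventually_ge_atTop m] with n hn
    rw [Complex.GammaSeq, Finset.prod_eq_zero (i := m) (by simp; lia) (by simp [hm]), div_zero,
      inv_zero]
  · exact (Complex.GammaSeq_tendsto_Gamma s).inv₀ h

/-- The coefficients of `₂F₁(a, b; c; z)` are asymptotic to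
`Γ(c) / (Γ(a) Γ(b)) · n ^ (a + b - c - 1)`. -/
theorem tendsto_ordinaryHypergeometricCoefficient (a b c : ℂ) :
    Tendsto (fun n : ℕ => (n + 1) * ordinaryHypergeometricCoefficient a b c (n + 1) /
      (n : ℂ) ^ (a + b - c)) atTop
      (𝓝 (Complex.Gamma c / (Complex.Gamma a * Complex.Gamma b))) := by
  have hc : Tendsto (fun n : ℕ => ((n : ℂ) ^ c * n.factorial) / (ascPochhammer ℂ (n + 1)).eval c)
      atTop (𝓝 (Complex.Gamma c)) := by
    convert! Complex.GammaSeq_tendsto_Gamma c using 2 with n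
    rw [Complex.GammaSeq, prod_range_add_eq_ascPochhammer]
  have h := ((tendsto_ascPochhammer_div a).mul (tendsto_ascPochhammer_div b)).mul hc
  rw [show Complex.Gamma c / (Complex.Gamma a * Complex.Gamma b) =
    (Complex.Gamma a)⁻¹ * (Complex.Gamma b)⁻¹ * Complex.Gamma c by
      rw [div_eq_mul_inv, mul_inv]; ring]
  refine h.congr' ?_
  filter_upwards [eventually_gt_atTop 0] with n hn
  have hn0 : (n : ℂ) ≠ 0 := by exact_mod_cast hn.ne'
  have h1 : (n.factorial : ℂ) ≠ 0 := by exact_mod_cast n.factorial_ne_zero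
  have h2 : (n : ℂ) + 1 ≠ 0 := by exact_mod_cast n.succ_ne_zero
  have hp : ∀ s : ℂ, (n : ℂ) ^ s ≠ 0 := fun s => by simp [Complex.cpow_eq_zero_iff, hn0]
  have ha := hp a
  have hb := hp b
  have hcc := hp c
  rw [Complex.cpow_sub _ _ hn0, Complex.cpow_add _ _ hn0]
  simp only [ordinaryHypergeometricCoefficient, Nat.factorial_succ]
  push_cast
  field_simp

theorem ordinaryHypergeometricCoefficient_ofReal (a b c : ℝ) (n : ℕ) :
    ordinaryHypergeometricCoefficient (a : ℂ) b c n =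
      ((ordinaryHypergeometricCoefficient a b c n : ℝ) : ℂ) := by
  have h : ∀ x : ℝ, (ascPochhammer ℂ n).eval (x : ℂ) = (((ascPochhammer ℝ n).eval x : ℝ) : ℂ) := by
    intro x
    rw [← ascPochhammer_map Complex.ofRealHom, Polynomial.eval_map, ← Complex.ofRealHom_eq_coe,
      Polynomial.eval₂_at_apply]
    simp
  simp only [ordinaryHypergeometricCoefficient, h]
  push_cast
  rfl

/-- If `Re (a + b - c) > 0`, then `₂F₁(a, b; c; x)` is asymptotic to
`Γ(c) Γ(a + b - c) / (Γ(a) Γ(b)) · (1 - x) ^ (c - a - b)` as `x → 1⁻`. -/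
theorem tendsto_ordinaryHypergeometric_mul_one_sub_cpow (a b c : ℂ)
    (hre : (c - a - b).re < 0) :
    Tendsto (fun x : ℝ => ₂F₁ a b c (x : ℂ) * (1 - (x : ℂ)) ^ (-(c - a - b))) (𝓝[<] 1)
      (𝓝 (Complex.Gamma c * Complex.Gamma (a + b - c) /
        (Complex.Gamma a * Complex.Gamma b))) := by
  set s : ℂ := a + b - c with hsdef
  have hds : -(c - a - b) = s := by rw [hsdef]; ring
  have hs : 0 < s.re := by rw [← hds, Complex.neg_re]; linarith
  set σ : ℝ := s.re with hσ
  set κ : ℂ := Complex.Gamma c * Complex.Gamma s / (Complex.Gamma a * Complex.Gamma b) with hκ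
  have hΓs : Complex.Gamma s ≠ 0 := Complex.Gamma_ne_zero_of_re_pos hs
  -- `r` is the positive coefficient sequence of `(1 - x) ^ (-Re s)`, the scale of comparison
  set r : ℕ → ℝ := ordinaryHypergeometricCoefficient σ 1 1
  have hrC : ∀ n, ordinaryHypergeometricCoefficient (σ : ℂ) 1 1 n = r n := fun n => by
    have h := ordinaryHypergeometricCoefficient_ofReal σ 1 1 n
    rwa [Complex.ofReal_one] at h
  have hrpos : ∀ n, 0 < r n := fun n => by
    have h1 : 0 < (ascPochhammer ℝ n).eval σ := ascPochhammer_pos n σ hs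
    have h2 : 0 < (ascPochhammer ℝ n).eval (1 : ℝ) := ascPochhammer_pos n 1 one_pos
    have h3 : (0 : ℝ) < n.factorial := by exact_mod_cast n.factorial_pos
    simp only [r, ordinaryHypergeometricCoefficient]
    positivity
  have hnorm : ∀ x ∈ Ioo (0 : ℝ) 1, ‖(x : ℂ)‖ < 1 := fun x hx => (mem_lens.1 (ofReal_mem_lens hx)).1
  have hrsum : ∀ x ∈ Ioo (0 : ℝ) 1, HasSum (fun n => r n * x ^ n) ((1 - x) ^ (-σ)) := by
    intro x hx
    have h := hasSum_ordinaryHypergeometric σ 1 1 (hnorm x hx)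
    rw [← one_sub_cpow_neg_eq_ordinaryHypergeometric _ (hnorm x hx)] at h
    simp only [hrC] at h
    rw [← Complex.hasSum_ofReal, Complex.ofReal_cpow (by linarith [hx.2])]
    simpa using h
  have hlim : Tendsto (fun x : ℝ => (1 - x) ^ (-σ)) (𝓝[<] 1) atTop := by
    have h0 : Tendsto (fun x : ℝ => 1 - x) (𝓝[<] 1) (𝓝[>] 0) := by
      refine tendsto_nhdsWithin_iff.2 ⟨?_, ?_⟩
      · have : Tendsto (fun x : ℝ => 1 - x) (𝓝 1) (𝓝 (1 - 1)) :=
          (continuous_const.sub continuous_id : Continuous fun x : ℝ => 1 - x).tendsto 1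
        simpa using this.mono_left nhdsWithin_le_nhds
      · filter_upwards [self_mem_nhdsWithin] with x hx
        simpa using hx
    exact (tendsto_rpow_neg_nhdsGT_zero (neg_lt_zero.2 hs)).comp h0
  -- `κ` is chosen so that the leading terms of the coefficients of `₂F₁(a, b; c; x)` and of
  -- `κ (1 - x) ^ (-s)` cancel
  set u : ℕ → ℂ := fun n => ordinaryHypergeometricCoefficient a b c n -
    κ * ordinaryHypergeometricCoefficient s 1 1 n with hu
  have hur : u =o[atTop] r := by
    rw [← isLittleO_norm_left, isLittleO_iff_tendsto (fun n h => absurd h (hrpos n).ne'),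
      ← tendsto_add_atTop_iff_nat 1]
    have h1 := tendsto_ordinaryHypergeometricCoefficient a b c
    have h2 := tendsto_ordinaryHypergeometricCoefficient s 1 1
    have h3 := tendsto_ordinaryHypergeometricCoefficient (σ : ℂ) 1 1
    rw [← hsdef] at h1
    simp only [add_sub_cancel_right, Complex.Gamma_one, mul_one, one_div] at h2 h3
    have hΓσ : (Complex.Gamma σ)⁻¹ ≠ 0 :=
      inv_ne_zero (Complex.Gamma_ne_zero_of_re_pos (by simpa using hs))
    have h4 := ((h1.sub (h2.const_mul κ)).norm).div h3.norm (norm_ne_zero_iff.2 hΓσ)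
    have hz : Complex.Gamma c / (Complex.Gamma a * Complex.Gamma b) - κ * (Complex.Gamma s)⁻¹ = 0 := by
      rw [hκ]
      field_simp
      ring
    rw [hz, norm_zero, zero_div] at h4
    refine h4.congr' ?_
    filter_upwards [eventually_gt_atTop 0] with n hn
    have hn0 : (n : ℂ) ≠ 0 := by exact_mod_cast hn.ne'
    have hn1 : ‖(n : ℂ) + 1‖ ≠ 0 := norm_ne_zero_iff.2 (by exact_mod_cast n.succ_ne_zero)
    have hns : ‖(n : ℂ) ^ s‖ = (n : ℝ) ^ σ := Complex.norm_natCast_cpow_of_pos hn s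
    have hnσ : ‖(n : ℂ) ^ (σ : ℂ)‖ = (n : ℝ) ^ σ := by
      rw [Complex.norm_natCast_cpow_of_pos hn, Complex.ofReal_re]
    have hp : (n : ℝ) ^ σ ≠ 0 := (Real.rpow_pos_of_pos (by exact_mod_cast hn) σ).ne'
    simp only [Pi.div_apply, hu]
    rw [hrC, ← mul_div_assoc, ← sub_div, mul_left_comm κ, ← mul_sub, norm_div, norm_div, norm_mul,
      norm_mul, hns, hnσ, Complex.norm_real, Real.norm_of_nonneg (hrpos _).le]
    have := (hrpos (n + 1)).ne'
    field_simp
  have hR : ∀ᶠ x : ℝ in 𝓝[<] 1, (1 - x) ^ (-σ) = ∑' n, r n * x ^ n := by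
    filter_upwards [eventually_mem_Ioo_zero_one] with x hx using (hrsum x hx).tsum_eq.symm
  have ho := tsum_mul_pow_isLittleO (fun n => (hrpos n).le) (fun x hx => (hrsum x hx).summable) hur
    (hlim.congr' hR)
  have ho' : Tendsto (fun x : ℝ => (∑' n, u n * (x : ℂ) ^ n) * (1 - (x : ℂ)) ^ s) (𝓝[<] 1)
      (𝓝 0) := by
    rw [tendsto_zero_iff_norm_tendsto_zero]
    refine ho.norm_left.tendsto_div_nhds_zero.congr' ?_
    filter_upwards [eventually_mem_Ioo_zero_one, hR] with x hx hRx
    have hx1 : 0 < 1 - x := by linarith [hx.2]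
    rw [← hRx, norm_mul, ← Complex.ofReal_one, ← Complex.ofReal_sub,
      Complex.norm_cpow_eq_rpow_re_of_pos hx1, Real.rpow_neg hx1.le, div_inv_eq_mul]
  have hfin := ho'.add_const κ
  rw [zero_add] at hfin
  rw [hds]
  refine hfin.congr' ?_
  filter_upwards [eventually_mem_Ioo_zero_one] with x hx
  have hx0 := Complex.slitPlane_ne_zero (one_sub_slitPlane_of_mem_lens (ofReal_mem_lens hx))
  have hsum := (hasSum_ordinaryHypergeometric a b c (hnorm x hx)).sub
    ((hasSum_ordinaryHypergeometric s 1 1 (hnorm x hx)).mul_left κ)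
  have he : ∑' n, u n * (x : ℂ) ^ n = ₂F₁ a b c (x : ℂ) - κ * ₂F₁ s 1 1 (x : ℂ) := by
    rw [← hsum.tsum_eq]
    refine tsum_congr fun n => ?_
    rw [hu]
    ring
  rw [he, ← one_sub_cpow_neg_eq_ordinaryHypergeometric _ (hnorm x hx), Complex.cpow_neg]
  have : (1 - (x : ℂ)) ^ s ≠ 0 := by simp [Complex.cpow_eq_zero_iff, hx0]
  field_simp
  ring

/-! ### The connection formula -/

theorem tendsto_one_sub_cpow_zero {s : ℂ} (hs : 0 < s.re) :
    Tendsto (fun x : ℝ => (1 - (x : ℂ)) ^ s) (𝓝[<] 1) (𝓝 0) := by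
  have h := (Complex.continuousAt_cpow_const_of_re_pos (z := 0) (w := s) (by simp) hs).tendsto
  rw [Complex.zero_cpow (by rintro rfl; simp at hs)] at h
  exact h.comp tendsto_one_sub_ofReal

/-- The coefficient of the fast solution in `₂F₁(a, b; c; z)`. For `Re (c - a - b) < 0` it is read
off from the growth at `z = 1`; differentiation lowers `c - a - b` by `1` and reduces the other
cases to this one. -/
theorem fast_coefficient {a b c A B : ℂ} (hc : ∀ n : ℕ, c ≠ -(n : ℂ))
    (hd : ∀ n : ℤ, c - a - b ≠ n)
    (h : ∀ z ∈ lens, ₂F₁ a b c z = A * gaussSlow a b c z + B * gaussFast a b c z) :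
    B = Complex.Gamma c * Complex.Gamma (a + b - c) /
      (Complex.Gamma a * Complex.Gamma b) := by
  obtain ⟨n, hn⟩ := exists_nat_gt (c - a - b).re
  induction n generalizing a b c A B with
  | zero =>
    rw [Nat.cast_zero] at hn
    have h1 := tendsto_ordinaryHypergeometric_mul_one_sub_cpow a b c hn
    have h2 := (((tendsto_ordinaryHypergeometric_one_sub a b (a + b - c + 1)).const_mul A).mul
      (tendsto_one_sub_cpow_zero (s := -(c - a - b)) (by simp at hn ⊢; linarith))).add
      ((tendsto_ordinaryHypergeometric_one_sub (c - a) (c - b) (c - a - b + 1)).const_mul B)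
    rw [mul_zero, zero_add, mul_one] at h2
    refine tendsto_nhds_unique_of_eventuallyEq h2 h1 ?_
    filter_upwards [eventually_mem_Ioo_zero_one] with x hx
    have hl := ofReal_mem_lens hx
    have hx0 := Complex.slitPlane_ne_zero (one_sub_slitPlane_of_mem_lens hl)
    have : (1 - (x : ℂ)) ^ (c - a - b) ≠ 0 := by simp [Complex.cpow_eq_zero_iff, hx0]
    rw [h x hl, gaussSlow, gaussFast, Complex.cpow_neg]
    field_simp
  | succ n ih =>
    by_cases hab : a * b = 0
    · -- both `₂F₁` and the slow solution are `1`
      have hone : ∀ z ∈ lens, gaussSlow a b c z = A * gaussSlow a b c z + B * gaussFast a b c z := by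
        intro z hz
        rw [← h z hz, gaussSlow]
        rcases mul_eq_zero.1 hab with rfl | rfl
        · rw [ordinaryHypergeometric_zero_left _ hc (mem_lens.1 hz).1,
            ordinaryHypergeometric_zero_left _ (slow_param_ne hd) (mem_lens.1 hz).2]
        · rw [ordinaryHypergeometric_zero_right _ hc (mem_lens.1 hz).1,
            ordinaryHypergeometric_zero_right _ (slow_param_ne hd) (mem_lens.1 hz).2]
      have hz : ((1 / 2 : ℝ) : ℂ) ∈ lens := ofReal_mem_lens (by norm_num)
      generalize ((1 / 2 : ℝ) : ℂ) = z at hz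
      have hs := (gaussSlow_hasDerivAt hd hz).differentiableAt.hasDerivAt
      have hf := (gaussFast_hasDerivAt hd hz).differentiableAt.hasDerivAt
      have he := hs.unique (((hs.const_mul A).add (hf.const_mul B)).congr_of_eventuallyEq (by
        filter_upwards [isOpen_lens.mem_nhds hz] with w hw using hone w hw))
      have hW := wronskian_gaussSlow_gaussFast hd hz
      have hz0 := Complex.slitPlane_ne_zero (slitPlane_of_mem_lens hz)
      have hz1 := Complex.slitPlane_ne_zero (one_sub_slitPlane_of_mem_lens hz)
      have hne : -(c - a - b) * (z ^ (-c) * (1 - z) ^ (c - a - b - 1)) ≠ 0 :=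
        mul_ne_zero (neg_ne_zero.2 (by simpa using hd 0)) (mul_ne_zero
          (by simp [Complex.cpow_eq_zero_iff, hz0]) (by simp [Complex.cpow_eq_zero_iff, hz1]))
      have hB : B = 0 := by
        refine (mul_eq_zero.1 (?_ : B * _ = 0)).resolve_right hne
        rw [← hW]
        linear_combination -gaussSlow a b c z * he + deriv (gaussSlow a b c) z * hone z hz
      rcases mul_eq_zero.1 hab with h0 | h0 <;> simp [hB, h0]
    · have ha : a ≠ 0 := left_ne_zero_of_mul hab
      have hb : b ≠ 0 := right_ne_zero_of_mul hab
      have hc0 : c ≠ 0 := by simpa using hc 0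
      have hd0 : c - a - b ≠ 0 := by simpa using hd 0
      have hs0 : a + b - c ≠ 0 := fun h => hd0 (by linear_combination -h)
      have key := ih (a := a + 1) (b := b + 1) (c := c + 1)
        (A := -(c / (a + b - c + 1)) * A) (B := -(c * (c - a - b) / (a * b)) * B)
        (ne_neg_natCast_add_one hc)
        (fun m hm => hd (m + 1) (by push_cast; linear_combination hm)) (fun z hz => by
          have e := (hasDerivAt_ordinaryHypergeometric a b hc (mem_lens.1 hz).1).unique
            ((((gaussSlow_hasDerivAt hd hz).const_mul A).add
              ((gaussFast_hasDerivAt hd hz).const_mul B)).congr_of_eventuallyEq (by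
                filter_upwards [isOpen_lens.mem_nhds hz] with w hw using h w hw))
          have hs1 : a + b - c + 1 ≠ 0 := by simpa using slow_param_ne hd 0
          refine mul_left_cancel₀ (div_ne_zero hab hc0) ?_
          rw [e]
          field_simp)
        (by
          push_cast at hn
          rw [show c + 1 - (a + 1) - (b + 1) = c - a - b - 1 by ring, Complex.sub_re,
            Complex.one_re]
          linarith)
      rw [show a + 1 + (b + 1) - (c + 1) = a + b - c + 1 by ring, Complex.Gamma_add_one _ hc0,
        Complex.Gamma_add_one _ ha, Complex.Gamma_add_one _ hb, Complex.Gamma_add_one _ hs0,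
        mul_mul_mul_comm a, mul_mul_mul_comm c, mul_div_mul_comm (c * _)] at key
      refine mul_left_cancel₀ (neg_ne_zero.2 (div_ne_zero (mul_ne_zero hc0 hd0) hab)) ?_
      rw [key]
      ring

/-- Gauss's connection formula between `z = 0` and `z = 1`. The slow coefficient is the fast
coefficient of the Euler transform. -/
theorem ordinaryHypergeometric_eq_slow_add_fast {a b c : ℂ} (hc : ∀ n : ℕ, c ≠ -(n : ℂ))
    (hd : ∀ n : ℤ, c - a - b ≠ n) {z : ℂ} (hz : z ∈ lens) :
    ₂F₁ a b c z =
      Complex.Gamma c * Complex.Gamma (c - a - b) / (Complex.Gamma (c - a) * Complex.Gamma (c - b)) *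
        gaussSlow a b c z +
      Complex.Gamma c * Complex.Gamma (a + b - c) / (Complex.Gamma a * Complex.Gamma b) *
        gaussFast a b c z := by
  have hd' : ∀ n : ℤ, c - (c - a) - (c - b) ≠ n := fun n h =>
    hd (-n) (by push_cast; linear_combination -h)
  have hsol := (isGaussSolutionOn_ordinaryHypergeometric (c - a) (c - b) hc).mono
    (inter_subset_left : lens ⊆ _)
  obtain ⟨A, B, h⟩ := hsol.exists_eq_slow_add_fast hd'
  have hB := fast_coefficient hc hd' h
  rw [show c - a + (c - b) - c = c - a - b by ring] at hB
  have h' : ∀ z ∈ lens, ₂F₁ a b c z = B * gaussSlow a b c z + A * gaussFast a b c z := by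
    intro z hz
    have hz1 := Complex.slitPlane_ne_zero (one_sub_slitPlane_of_mem_lens hz)
    have hp : (1 - z) ^ (c - a - b) ≠ 0 := by simp [Complex.cpow_eq_zero_iff, hz1]
    rw [ordinaryHypergeometric_eq_one_sub_cpow_mul a b hc (mem_lens.1 hz).1, h z hz]
    simp only [gaussSlow, gaussFast]
    rw [show c - (c - a) - (c - b) = -(c - a - b) by ring, Complex.cpow_neg,
      show c - a + (c - b) - c + 1 = c - a - b + 1 by ring, sub_sub_cancel, sub_sub_cancel,
      show -(c - a - b) + 1 = a + b - c + 1 by ring]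
    field_simp
    ring
  rw [h' z hz, hB, fast_coefficient hc hd h']

/-! ### Analytic dependence on the parameters -/

/-- `₂F₁(a, b; c; x)` with `|x| < 1` depends analytically on its parameters: the coefficients are
dominated, locally uniformly in the parameters, by those of a fixed series with radius of
convergence `1`. -/
theorem AnalyticAt.ordinaryHypergeometric {a b c : ℂ → ℂ} {ω₀ : ℂ} (ha : AnalyticAt ℂ a ω₀)
    (hb : AnalyticAt ℂ b ω₀) (hc : AnalyticAt ℂ c ω₀) (hc0 : ∀ n : ℕ, c ω₀ ≠ -(n : ℂ)) {x : ℂ}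
    (hx : ‖x‖ < 1) :
    AnalyticAt ℂ (fun ω => ₂F₁ (a ω) (b ω) (c ω) x) ω₀ := by
  obtain ⟨M, hMa, hMb, hMc⟩ : ∃ M : ℝ, ‖a ω₀‖ < M ∧ ‖b ω₀‖ < M ∧ ‖c ω₀‖ < M :=
    ⟨max (‖a ω₀‖) (max (‖b ω₀‖) (‖c ω₀‖)) + 1,
      (le_max_left _ _).trans_lt (lt_add_one _),
      ((le_max_left _ _).trans (le_max_right _ _)).trans_lt (lt_add_one _),
      ((le_max_right _ _).trans (le_max_right _ _)).trans_lt (lt_add_one _)⟩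
  have hM : 0 < M := (norm_nonneg _).trans_lt hMa
  obtain ⟨K, hK⟩ := exists_nat_gt M
  -- lower bounds for `|c + k|`: continuity at `ω₀` for finitely many `k`, `k - M` for the others
  set e : ℕ → ℝ := fun k => if k < K then ‖c ω₀ + k‖ / 2 else k - M with he
  have hck : ∀ k : ℕ, c ω₀ + k ≠ 0 := fun k h => hc0 k (eq_neg_of_add_eq_zero_left h)
  have hepos : ∀ k, 0 < e k := by
    intro k
    simp only [he]
    split_ifs with h
    · exact half_pos (norm_pos_iff.2 (hck k))
    · have : (K : ℝ) ≤ k := by exact_mod_cast not_lt.1 h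
      linarith
  set m : ℕ → ℝ := fun k => (M + k) ^ 2 / (e k * (k + 1)) with hm
  have hmpos : ∀ k, 0 < m k := fun k => by
    have := hepos k
    simp only [hm]
    positivity
  have hfin : ∀ᶠ ω in 𝓝 ω₀, ∀ k ∈ Finset.range K, ‖c ω₀ + k‖ / 2 < ‖c ω + k‖ := by
    rw [Filter.eventually_all_finset]
    intro k _
    have hcont : ContinuousAt (fun ω => ‖c ω + k‖) ω₀ :=
      (hc.continuousAt.add continuousAt_const).norm
    exact hcont.eventually_const_lt (half_lt_self (norm_pos_iff.2 (hck k)))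
  obtain ⟨V, hVsub, hVo, hV0⟩ := mem_nhds_iff.1 (((((ha.eventually_analyticAt.and
    hb.eventually_analyticAt).and hc.eventually_analyticAt).and
    (ha.continuousAt.norm.eventually_lt_const hMa)).and
    (hb.continuousAt.norm.eventually_lt_const hMb)).and
    ((hc.continuousAt.norm.eventually_lt_const hMc).and hfin))
  have hlow : ∀ ω ∈ V, ∀ k : ℕ, e k ≤ ‖c ω + k‖ := by
    intro ω hω k
    obtain ⟨-, h1, h2⟩ := hVsub hω
    simp only [he]
    split_ifs with h
    · exact (h2 k (Finset.mem_range.2 h)).le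
    · have h3 := norm_sub_norm_le (k : ℂ) (-c ω)
      rw [norm_neg, Complex.norm_natCast, sub_neg_eq_add, add_comm (k : ℂ)] at h3
      linarith
  have hne : ∀ ω ∈ V, ∀ k : ℕ, c ω ≠ -(k : ℂ) := by
    intro ω hω k h
    have := (hepos k).trans_le (hlow ω hω k)
    rw [h, neg_add_cancel, norm_zero] at this
    exact this.false
  have hbound : ∀ ω ∈ V, ∀ n : ℕ,
      ‖ordinaryHypergeometricCoefficient (a ω) (b ω) (c ω) n‖ ≤ ∏ k ∈ Finset.range n, m k := by
    intro ω hω n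
    induction n with
    | zero => simp
    | succ n ih =>
      have h := congrArg norm (ordinaryHypergeometricCoefficient_succ (a ω) (b ω) (hne ω hω) n)
      generalize ordinaryHypergeometricCoefficient (a ω) (b ω) (c ω) (n + 1) = v at h ⊢
      generalize ordinaryHypergeometricCoefficient (a ω) (b ω) (c ω) n = u at h ih
      obtain ⟨⟨⟨-, h1⟩, h2⟩, -⟩ := hVsub hω
      have hn : ‖(n : ℂ) + 1‖ = n + 1 := by
        rw [← Nat.cast_add_one, Complex.norm_natCast, Nat.cast_add_one]
      have hn1 : (0 : ℝ) < n + 1 := by positivity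
      have hen := hlow ω hω n
      have hpn := hepos n
      have ha' : ‖a ω + n‖ ≤ M + n := (norm_add_le _ _).trans (by
        rw [Complex.norm_natCast]; exact add_le_add_left h1.le _)
      have hb' : ‖b ω + n‖ ≤ M + n := (norm_add_le _ _).trans (by
        rw [Complex.norm_natCast]; exact add_le_add_left h2.le _)
      have hP : 0 ≤ ∏ k ∈ Finset.range n, m k := Finset.prod_nonneg fun k _ => (hmpos k).le
      rw [norm_mul, norm_mul, norm_mul, norm_mul, hn] at h
      rw [Finset.prod_range_succ]
      have h3 : (n + 1) * e n * ‖v‖ ≤ (M + n) * (M + n) * ∏ k ∈ Finset.range n, m k := calc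
        _ ≤ (n + 1) * ‖c ω + n‖ * ‖v‖ := by gcongr
        _ = _ := h
        _ ≤ _ := by gcongr
      simp only [hm]
      rw [mul_div_assoc', le_div_iff₀ (by positivity)]
      linarith
  obtain ⟨ρ, hxρ, hρ⟩ := exists_between hx
  have hρ0 : 0 < ρ := (norm_nonneg x).trans_lt hxρ
  have hsum : Summable fun n => (∏ k ∈ Finset.range n, m k) * ρ ^ n := by
    have hpos : ∀ n, 0 < (∏ k ∈ Finset.range n, m k) * ρ ^ n := fun n =>
      mul_pos (Finset.prod_pos fun k _ => hmpos k) (pow_pos hρ0 n)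
    refine summable_of_ratio_test_tendsto_lt_one hρ (Eventually.of_forall fun n => (hpos n).ne') ?_
    have h1 : Tendsto (fun n : ℕ => (M + 1 * n) / (-M + 1 * n) * ((M + 1 * n) / (1 + 1 * n)) * ρ)
        atTop (𝓝 (1 / 1 * (1 / 1) * ρ)) :=
      ((tendsto_add_mul_div_add_mul_atTop_nhds _ _ _ one_ne_zero).mul
        (tendsto_add_mul_div_add_mul_atTop_nhds _ _ _ one_ne_zero)).mul_const ρ
    rw [div_one, one_mul, one_mul] at h1
    refine h1.congr' ?_
    filter_upwards [eventually_ge_atTop K] with n hn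
    have hKn : (K : ℝ) ≤ n := by exact_mod_cast hn
    have h2 : (n : ℝ) - M ≠ 0 := by linarith
    have h3 : (∏ k ∈ Finset.range n, m k) ≠ 0 := (Finset.prod_pos fun k _ => hmpos k).ne'
    rw [Real.norm_of_nonneg (hpos _).le, Real.norm_of_nonneg (hpos _).le, Finset.prod_range_succ,
      pow_succ]
    have h4 : m n = (M + n) ^ 2 / ((n - M) * (n + 1)) := by
      simp only [hm, he, if_neg (not_lt.2 hn)]
    rw [h4]
    simp only [one_mul, neg_add_eq_sub]
    field_simp
    ring
  have hdiff : DifferentiableOn ℂ (fun ω => ∑' n : ℕ,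
      ordinaryHypergeometricCoefficient (a ω) (b ω) (c ω) n * x ^ n) V := by
    refine Complex.differentiableOn_tsum_of_summable_norm hsum (fun n => ?_) hVo fun n ω hω => ?_
    · intro ω hω
      obtain ⟨⟨⟨⟨⟨h1, h2⟩, h3⟩, -⟩, -⟩, -⟩ := hVsub hω
      have hp : ∀ {f : ℂ → ℂ}, AnalyticAt ℂ f ω →
          DifferentiableAt ℂ (fun ω => (ascPochhammer ℂ n).eval (f ω)) ω := fun hf =>
        ((ascPochhammer ℂ n).differentiable.differentiableAt).comp ω hf.differentiableAt
      exact (((((differentiableAt_const _).mul (hp h1)).mul (hp h2)).mul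
        ((hp h3).inv (ascPochhammer_eval_ne_zero (hne ω hω) n))).mul_const
        _).differentiableWithinAt
    · rw [norm_mul, norm_pow]
      exact mul_le_mul (hbound ω hω n) (pow_le_pow_left₀ (norm_nonneg _) hxρ.le n)
        (by positivity) (Finset.prod_nonneg fun k _ => (hmpos k).le)
  refine (hdiff.analyticAt (hVo.mem_nhds hV0)).congr (Eventually.of_forall fun ω => ?_)
  exact (hasSum_ordinaryHypergeometric (a ω) (b ω) (c ω) hx).tsum_eq

theorem AnalyticAt.Gamma_inv {f : ℂ → ℂ} {ω₀ : ℂ} (hf : AnalyticAt ℂ f ω₀) :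
    AnalyticAt ℂ (fun ω => (Complex.Gamma (f ω))⁻¹) ω₀ :=
  (Complex.differentiable_one_div_Gamma.analyticAt (f ω₀)).comp hf

theorem AnalyticAt.Gamma {f : ℂ → ℂ} {ω₀ : ℂ} (hf : AnalyticAt ℂ f ω₀)
    (h : ∀ n : ℕ, f ω₀ ≠ -(n : ℂ)) :
    AnalyticAt ℂ (fun ω => Complex.Gamma (f ω)) ω₀ := by
  simpa only [inv_inv] using hf.Gamma_inv.fun_inv (inv_ne_zero (Complex.Gamma_ne_zero h))

/-! ### Double zeros and double poles -/

theorem analyticOrderAt_eq_two_iff {f : ℂ → ℂ} {ω₀ : ℂ} (hf : AnalyticAt ℂ f ω₀) :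
    analyticOrderAt f ω₀ = 2 ↔ f ω₀ = 0 ∧ deriv f ω₀ = 0 ∧ deriv (deriv f) ω₀ ≠ 0 := by
  have h := analyticOrderAt_eq_nat_iff_iteratedDeriv_eq_zero hf (n := 2)
  rw [Nat.cast_ofNat] at h
  rw [h]
  constructor
  · rintro ⟨h1, h2⟩
    exact ⟨by simpa using h1 0 (by simp), by simpa using h1 1 (by simp),
      by simpa [iteratedDeriv_succ] using h2⟩
  · rintro ⟨h0, h1, h2⟩
    refine ⟨fun k hk => ?_, by simpa [iteratedDeriv_succ] using h2⟩
    interval_cases k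
    · simpa using h0
    · simpa using h1

/-- A quotient with nonvanishing numerator has a pole of exact order two precisely at the double
zeros of the denominator. -/
theorem meromorphicOrderAt_div_eq_neg_two_iff {g h f : ℂ → ℂ} {ω₀ : ℂ} (hh : AnalyticAt ℂ h ω₀)
    (hh0 : h ω₀ ≠ 0) (hf : AnalyticAt ℂ f ω₀) (hg : ∀ᶠ ω in 𝓝 ω₀, g ω = h ω / f ω) :
    (MeromorphicAt g ω₀ ∧ meromorphicOrderAt g ω₀ = -2) ↔
      (f ω₀ = 0 ∧ deriv f ω₀ = 0 ∧ deriv (deriv f) ω₀ ≠ 0) := by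
  have hg' : g =ᶠ[𝓝[≠] ω₀] h / f := hg.filter_mono nhdsWithin_le_nhds
  have hmer : MeromorphicAt g ω₀ := (hh.meromorphicAt.div hf.meromorphicAt).congr hg'.symm
  rw [← analyticOrderAt_eq_two_iff hf, meromorphicOrderAt_congr hg',
    meromorphicOrderAt_div hh.meromorphicAt hf.meromorphicAt, hh.meromorphicOrderAt_eq,
    hf.meromorphicOrderAt_eq, hh.analyticOrderAt_eq_zero.2 hh0]
  simp only [hmer, true_and]
  cases analyticOrderAt f ω₀ with
  | top => simpa using (WithTop.coe_ne_top (a := (-2 : ℤ))).symm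
  | coe n =>
    change ((0 - (n : ℤ) : ℤ) : WithTop ℤ) = ((-2 : ℤ) : WithTop ℤ) ↔ (n : ℕ∞) = ((2 : ℕ) : ℕ∞)
    rw [WithTop.coe_inj, Nat.cast_inj]
    lia

/-- The principal part at a double zero `ω₀` of the denominator: `f` behaves like
`f''(ω₀) / 2 * (ω - ω₀) ^ 2`. -/
theorem div_sub_isBigO_of_double_zero {g h f : ℂ → ℂ} {ω₀ : ℂ} (hh : AnalyticAt ℂ h ω₀)
    (hf : AnalyticAt ℂ f ω₀) (hg : ∀ᶠ ω in 𝓝 ω₀, g ω = h ω / f ω)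
    (hf2 : f ω₀ = 0 ∧ deriv f ω₀ = 0 ∧ deriv (deriv f) ω₀ ≠ 0) :
    (fun ω => g ω - 2 / (ω - ω₀) ^ 2 * (h ω₀ / deriv (deriv f) ω₀)) =O[𝓝[≠] ω₀]
      fun ω => 1 / (ω - ω₀) := by
  obtain ⟨k, hk, hk0, hfk⟩ := hf.analyticOrderAt_eq_natCast.1
    ((analyticOrderAt_eq_two_iff hf).2 hf2 : analyticOrderAt f ω₀ = ((2 : ℕ) : ℕ∞))
  have hk2 : deriv (deriv f) ω₀ = 2 * k ω₀ := by
    have hd : deriv f =ᶠ[𝓝 ω₀]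
        fun ω => 2 * (ω - ω₀) * k ω + (ω - ω₀) ^ 2 * deriv k ω := by
      filter_upwards [hk.eventually_analyticAt, hfk.eventually_nhds] with ω hω hfω
      have h1 := (((hasDerivAt_id ω).sub_const ω₀).pow 2).mul (hω.differentiableAt.hasDerivAt)
      have h2 := (h1.congr_of_eventuallyEq (f₁ := f) (by
        filter_upwards [hfω] with x hx using by simpa using hx)).deriv
      rw [h2]
      simp
    have h1 := ((((hasDerivAt_id ω₀).sub_const ω₀).const_mul 2).mul
      hk.differentiableAt.hasDerivAt).add
      ((((hasDerivAt_id ω₀).sub_const ω₀).pow 2).mul hk.deriv.differentiableAt.hasDerivAt)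
    rw [(h1.congr_of_eventuallyEq hd).deriv]
    simp
  have hq : AnalyticAt ℂ (fun ω => h ω / k ω) ω₀ := hh.fun_div hk hk0
  have hO : (fun ω => h ω / k ω - h ω₀ / k ω₀) =O[𝓝[≠] ω₀] fun ω => ω - ω₀ :=
    hq.differentiableAt.isBigO_sub.mono nhdsWithin_le_nhds
  refine ((hO.mul (isBigO_refl (fun ω => 1 / (ω - ω₀) ^ 2) (𝓝[≠] ω₀))).congr' ?_ ?_)
  · filter_upwards [hg.filter_mono nhdsWithin_le_nhds, hfk.filter_mono nhdsWithin_le_nhds,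
      self_mem_nhdsWithin, (hk.continuousAt.eventually_ne hk0).filter_mono nhdsWithin_le_nhds]
      with ω h1 h2 h3 h4
    have h5 : ω - ω₀ ≠ 0 := sub_ne_zero.2 h3
    rw [h1, h2, hk2, smul_eq_mul]
    field_simp
  · filter_upwards [self_mem_nhdsWithin] with ω h3
    have h5 : ω - ω₀ ≠ 0 := sub_ne_zero.2 h3
    field_simp

/-! ### The exponents of the radial problem -/

namespace RadialProblem

variable {S : RadialProblem} {U : Set ℂ} {ω : ℂ}

theorem ofReal_ne_zero_of_mem_Ioo {t : ℝ} (ht : t ∈ Ioo (0 : ℝ) 1) : (t : ℂ) ≠ 0 :=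
  Complex.slitPlane_ne_zero (slitPlane_of_mem_lens (ofReal_mem_lens ht))

theorem one_sub_ofReal_ne_zero_of_mem_Ioo {t : ℝ} (ht : t ∈ Ioo (0 : ℝ) 1) : 1 - (t : ℂ) ≠ 0 :=
  Complex.slitPlane_ne_zero (one_sub_slitPlane_of_mem_lens (ofReal_mem_lens ht))

theorem prefactor_ne_zero {t : ℝ} (ht : t ∈ Ioo (0 : ℝ) 1) : S.prefactor ω t ≠ 0 :=
  mul_ne_zero (by simp [Complex.cpow_eq_zero_iff, ofReal_ne_zero_of_mem_Ioo ht])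
    (by simp [Complex.cpow_eq_zero_iff, one_sub_ofReal_ne_zero_of_mem_Ioo ht])

theorem hasDerivAt_prefactor {t : ℝ} (ht : t ∈ Ioo (0 : ℝ) 1) :
    HasDerivAt (S.prefactor ω)
      (S.prefactor ω t * (S.ρ₀ ω / t - S.ρ₁ ω / (1 - t))) t := by
  have hl := ofReal_mem_lens ht
  have h0 := ofReal_ne_zero_of_mem_Ioo ht
  have h1 := one_sub_ofReal_ne_zero_of_mem_Ioo ht
  have h := (((hasDerivAt_id (t : ℂ)).cpow_const (c := S.ρ₀ ω) (slitPlane_of_mem_lens hl)).mul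
    (hasDerivAt_one_sub_cpow (S.ρ₁ ω) (one_sub_slitPlane_of_mem_lens hl))).comp_ofReal
  refine h.congr_deriv ?_
  simp only [id, prefactor, cpow_sub_one_eq_div h0, cpow_sub_one_eq_div h1]
  field_simp
  ring

/-- Applying the hypothesis to `f = 1` and to `f = z` and eliminating `Q` determines `P`. -/
theorem IsHypergeometricOn.P_eq (h : S.IsHypergeometricOn U) (hω : ω ∈ U) {t : ℝ}
    (ht : t ∈ Ioo (0 : ℝ) 1) :
    S.P ω t = (S.c ω - 2 * S.ρ₀ ω) / t + (S.c ω - S.a ω - S.b ω - 1 + 2 * S.ρ₁ ω) / (1 - t) := by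
  have h0 := ofReal_ne_zero_of_mem_Ioo ht
  have h1 := one_sub_ofReal_ne_zero_of_mem_Ioo ht
  have hφ := prefactor_ne_zero (S := S) (ω := ω) ht
  have hid : ∀ s : ℝ, HasDerivAt (fun s : ℝ => (s : ℂ)) 1 s := fun s =>
    (hasDerivAt_id (s : ℂ)).comp_ofReal
  set D : ℝ → ℂ := fun s => S.prefactor ω s * (S.ρ₀ ω / s - S.ρ₁ ω / (1 - s)) with hD
  have hnear : ∀ᶠ s in 𝓝 t, s ∈ Ioo (0 : ℝ) 1 := isOpen_Ioo.mem_nhds ht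
  have hD' : HasDerivAt D (deriv D t) t :=
    (((hasDerivAt_prefactor ht).mul
      (((hasDerivAt_const t (S.ρ₀ ω)).div (hid t) h0).sub
        ((hasDerivAt_const t (S.ρ₁ ω)).div ((hid t).const_sub 1) h1)))).differentiableAt.hasDerivAt
  have e1 := h ω hω (fun _ => 1) contDiffOn_const t ht
  have e2 := h ω hω (fun s => (s : ℂ)) Complex.ofRealCLM.contDiff.contDiffOn t ht
  have d1 : deriv (fun s => S.prefactor ω s * 1) =ᶠ[𝓝 t] D := by
    filter_upwards [hnear] with s hs
    simpa using (hasDerivAt_prefactor (S := S) (ω := ω) hs).deriv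
  have d2 : deriv (fun s : ℝ => S.prefactor ω s * (s : ℂ)) =ᶠ[𝓝 t]
      fun s => D s * s + S.prefactor ω s * 1 := by
    filter_upwards [hnear] with s hs
    exact ((hasDerivAt_prefactor (S := S) (ω := ω) hs).mul (hid s)).deriv
  have d3 : deriv (fun s : ℝ => (s : ℂ)) = fun _ => 1 := funext fun s => (hid s).deriv
  have d4 : deriv (fun s : ℝ => D s * s + S.prefactor ω s * 1) t =
      deriv D t * t + D t * 1 + D t * 1 :=
    ((hD'.mul (hid t)).add ((hasDerivAt_prefactor ht).mul_const 1)).deriv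
  simp only [radialOperator, gaussOperator, d1.deriv_eq, d1.eq_of_nhds, d2.deriv_eq, d2.eq_of_nhds,
    d3, d4, deriv_const', mul_zero, zero_add] at e1 e2
  have e3 : (t : ℂ) * (1 - t) * (2 * D t + S.P ω t * S.prefactor ω t) =
      S.prefactor ω t * (S.c ω - (S.a ω + S.b ω + 1) * t) := by
    linear_combination e2 - t * e1
  have e4 : (t : ℂ) * (1 - t) * D t =
      S.prefactor ω t * (S.ρ₀ ω * (1 - t) - S.ρ₁ ω * t) := by
    simp only [hD]
    field_simp
  have e5 : (t : ℂ) * (1 - t) * S.P ω t = S.c ω - (S.a ω + S.b ω + 1) * t -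
      2 * (S.ρ₀ ω * (1 - t) - S.ρ₁ ω * t) :=
    mul_left_cancel₀ hφ (by linear_combination e3 - 2 * e4)
  refine mul_left_cancel₀ (mul_ne_zero h0 h1) ?_
  rw [e5]
  field_simp
  ring

/-- The indefinite integral of `P` is a combination of `log z` and `log (1 - z)`, up to a constant. -/
theorem intP_sub_intP (h : S.IsHypergeometricOn U) (hint : S.IsIndefiniteIntegralOn U)
    (hω : ω ∈ U) {s t : ℝ} (hs : s ∈ Ioo (0 : ℝ) 1) (ht : t ∈ Ioo (0 : ℝ) 1) :
    S.intP ω s - S.intP ω t = (S.c ω - 2 * S.ρ₀ ω) * (Real.log s - Real.log t : ℝ) -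
      (S.c ω - S.a ω - S.b ω - 1 + 2 * S.ρ₁ ω) *
        (Real.log (1 - s) - Real.log (1 - t) : ℝ) := by
  set X := S.c ω - 2 * S.ρ₀ ω with hX
  set Y := S.c ω - S.a ω - S.b ω - 1 + 2 * S.ρ₁ ω with hY
  have hd : ∀ x ∈ Ioo (0 : ℝ) 1, HasDerivAt (fun x : ℝ => S.intP ω x - (X * (Real.log x : ℝ) -
      Y * (Real.log (1 - x) : ℝ))) 0 x := by
    intro x hx
    have h1 := (hint.1 ω hω x hx).sub
      ((((Real.hasDerivAt_log hx.1.ne').ofReal_comp).const_mul X).sub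
      (((((hasDerivAt_id x).const_sub 1).log (by simp; linarith [hx.2])).ofReal_comp).const_mul Y))
    refine h1.congr_deriv ?_
    have hx0 := ofReal_ne_zero_of_mem_Ioo hx
    have hx1 := one_sub_ofReal_ne_zero_of_mem_Ioo hx
    rw [h.P_eq hω hx]
    simp only [id]
    push_cast
    field_simp
    ring
  have := isOpen_Ioo.is_const_of_deriv_eq_zero isPreconnected_Ioo
    (fun x hx => (hd x hx).differentiableAt.differentiableWithinAt) (fun x hx => (hd x hx).deriv)
    hs ht
  push_cast
  linear_combination this

/-- The exponents are analytic in the frequency: three values of the indefinite integral of `P`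
determine the coefficients of `log z` and `log (1 - z)` in it. -/
theorem analyticAt_exponents (hU : IsOpen U) (h : S.IsHypergeometricOn U)
    (hint : S.IsIndefiniteIntegralOn U) (hA1 : S.AssumptionA1 U) (hω : ω ∈ U) :
    AnalyticAt ℂ S.ρ₀ ω ∧ AnalyticAt ℂ S.ρ₁ ω := by
  set L := Real.log 2
  set M := Real.log (3 / 2)
  have hM : 0 < M := Real.log_pos (by norm_num)
  have hML : M < L := Real.log_lt_log (by norm_num) (by norm_num)
  have l2 : Real.log (1 / 2) = -L := by rw [one_div, Real.log_inv]
  have l4 : Real.log (1 / 4) = -(2 * L) := by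
    rw [one_div, Real.log_inv, show (4 : ℝ) = 2 ^ 2 by norm_num, Real.log_pow]
    norm_num [L]
  have l34 : Real.log (3 / 4) = M - L := by
    rw [← Real.log_div (by norm_num) (by norm_num)]
    norm_num
  have hD : ((M : ℂ) ^ 2 - (L : ℂ) ^ 2) ≠ 0 := by
    have : M ^ 2 - L ^ 2 ≠ 0 := by nlinarith
    exact_mod_cast this
  have m2 : (1 / 2 : ℝ) ∈ Ioo (0 : ℝ) 1 := by norm_num
  have m4 : (1 / 4 : ℝ) ∈ Ioo (0 : ℝ) 1 := by norm_num
  have m34 : (3 / 4 : ℝ) ∈ Ioo (0 : ℝ) 1 := by norm_num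
  have i2 := hint.2 _ m2 ω hω
  have i4 := hint.2 _ m4 ω hω
  have i34 := hint.2 _ m34 ω hω
  obtain ⟨ha, hb, hc⟩ := hA1
  have ha := ha ω hω
  have hb := hb ω hω
  have hc := hc ω hω
  have key : ∀ ω ∈ U, S.intP ω (1 / 4) - S.intP ω (1 / 2) = -L * (S.c ω - 2 * S.ρ₀ ω) -
        M * (S.c ω - S.a ω - S.b ω - 1 + 2 * S.ρ₁ ω) ∧
      S.intP ω (3 / 4) - S.intP ω (1 / 2) = M * (S.c ω - 2 * S.ρ₀ ω) +
        L * (S.c ω - S.a ω - S.b ω - 1 + 2 * S.ρ₁ ω) := by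
    intro ω hω
    rw [intP_sub_intP h hint hω m4 m2, intP_sub_intP h hint hω m34 m2,
      show (1 - 1 / 4 : ℝ) = 3 / 4 by norm_num, show (1 - 3 / 4 : ℝ) = 1 / 4 by norm_num,
      show (1 - 1 / 2 : ℝ) = 1 / 2 by norm_num, l2, l4, l34]
    push_cast
    constructor <;> ring
  constructor
  · have hE : AnalyticAt ℂ (fun ω => (S.c ω - (L * (S.intP ω (1 / 4) - S.intP ω (1 / 2)) +
        M * (S.intP ω (3 / 4) - S.intP ω (1 / 2))) / ((M : ℂ) ^ 2 - (L : ℂ) ^ 2)) / 2) ω := by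
      fun_prop
    refine hE.congr ?_
    filter_upwards [hU.mem_nhds hω] with ω hω
    obtain ⟨h1, h2⟩ := key ω hω
    rw [h1, h2]
    field_simp
    ring
  · have hE : AnalyticAt ℂ (fun ω => (-(M * (S.intP ω (1 / 4) - S.intP ω (1 / 2)) +
        L * (S.intP ω (3 / 4) - S.intP ω (1 / 2))) / ((M : ℂ) ^ 2 - (L : ℂ) ^ 2) -
        (S.c ω - S.a ω - S.b ω - 1)) / 2) ω := by
      fun_prop
    refine hE.congr ?_
    filter_upwards [hU.mem_nhds hω] with ω hω
    obtain ⟨h1, h2⟩ := key ω hω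
    rw [h1, h2]
    field_simp
    ring
end RadialProblem

/-! ### The solutions of the radial problem and their Wronskians -/

namespace RadialProblem

variable {S : RadialProblem} {U : Set ℂ} {ω : ℂ}

theorem Rslow_eq (t : ℝ) :
    S.Rslow ω t = S.prefactor ω t * gaussSlow (S.a ω) (S.b ω) (S.c ω) t := rfl

theorem Rfast_eq {t : ℝ} (ht : t ∈ Ioo (0 : ℝ) 1) :
    S.Rfast ω t = S.prefactor ω t * gaussFast (S.a ω) (S.b ω) (S.c ω) t := by
  rw [Rfast, prefactor, gaussFast,
    show S.ρ₁ ω + S.c ω - S.a ω - S.b ω = S.ρ₁ ω + (S.c ω - S.a ω - S.b ω) by ring,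
    Complex.cpow_add _ _ (one_sub_ofReal_ne_zero_of_mem_Ioo ht)]
  ring

theorem Rin_eq (hc : ∀ n : ℕ, S.c ω ≠ -(n : ℂ)) (hd : ∀ n : ℤ, S.c ω - S.a ω - S.b ω ≠ n)
    {t : ℝ} (ht : t ∈ Ioo (0 : ℝ) 1) :
    S.Rin ω t = S.Cslow ω * S.Rslow ω t + S.Cfast ω * S.Rfast ω t := by
  rw [Rin, ordinaryHypergeometric_eq_slow_add_fast hc hd (ofReal_mem_lens ht), Rslow_eq,
    Rfast_eq ht, Cslow, Cfast]
  ring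

theorem hasDerivAt_Rslow (hd : ∀ n : ℤ, S.c ω - S.a ω - S.b ω ≠ n)
    {t : ℝ} (ht : t ∈ Ioo (0 : ℝ) 1) :
    HasDerivAt (S.Rslow ω) (S.prefactor ω t * (S.ρ₀ ω / t - S.ρ₁ ω / (1 - t)) *
        gaussSlow (S.a ω) (S.b ω) (S.c ω) t +
      S.prefactor ω t * deriv (gaussSlow (S.a ω) (S.b ω) (S.c ω)) t) t :=
  (hasDerivAt_prefactor ht).mul
    ((gaussSlow_hasDerivAt hd (ofReal_mem_lens ht)).differentiableAt.hasDerivAt.comp_ofReal)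

theorem hasDerivAt_Rfast (hd : ∀ n : ℤ, S.c ω - S.a ω - S.b ω ≠ n)
    {t : ℝ} (ht : t ∈ Ioo (0 : ℝ) 1) :
    HasDerivAt (S.Rfast ω) (S.prefactor ω t * (S.ρ₀ ω / t - S.ρ₁ ω / (1 - t)) *
        gaussFast (S.a ω) (S.b ω) (S.c ω) t +
      S.prefactor ω t * deriv (gaussFast (S.a ω) (S.b ω) (S.c ω)) t) t := by
  refine ((hasDerivAt_prefactor ht).mul ((gaussFast_hasDerivAt hd
    (ofReal_mem_lens ht)).differentiableAt.hasDerivAt.comp_ofReal)).congr_of_eventuallyEq ?_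
  filter_upwards [isOpen_Ioo.mem_nhds ht] with s hs using Rfast_eq hs

theorem Wsf_eq (hd : ∀ n : ℤ, S.c ω - S.a ω - S.b ω ≠ n) {t : ℝ} (ht : t ∈ Ioo (0 : ℝ) 1) :
    S.Wsf ω t = S.prefactor ω t ^ 2 * (-(S.c ω - S.a ω - S.b ω) *
      ((t : ℂ) ^ (-S.c ω) * (1 - (t : ℂ)) ^ (S.c ω - S.a ω - S.b ω - 1))) := by
  rw [Wsf, radialWronskian, (hasDerivAt_Rfast hd ht).deriv, (hasDerivAt_Rslow hd ht).deriv,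
    Rslow_eq, Rfast_eq ht, ← wronskian_gaussSlow_gaussFast hd (ofReal_mem_lens ht)]
  ring

/-- The quantization function is, up to sign, the Wronskian of the ingoing solution and the solution
adapted to the boundary condition, relative to that of the slow and the fast solution. -/
theorem radialWronskian_Rin_RB (hc : ∀ n : ℕ, S.c ω ≠ -(n : ℂ))
    (hd : ∀ n : ℤ, S.c ω - S.a ω - S.b ω ≠ n) {t : ℝ} (ht : t ∈ Ioo (0 : ℝ) 1) :
    radialWronskian (S.Rin ω) (S.RB ω) t = -(S.F ω * S.Wsf ω t) := by
  have hs := (hasDerivAt_Rslow hd ht).differentiableAt.hasDerivAt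
  have hf := (hasDerivAt_Rfast hd ht).differentiableAt.hasDerivAt
  have hin := ((hs.const_mul (S.Cslow ω)).add (hf.const_mul (S.Cfast ω))).congr_of_eventuallyEq
    (f₁ := S.Rin ω) (by
      filter_upwards [isOpen_Ioo.mem_nhds ht] with s hs using Rin_eq hc hd hs)
  have hB : HasDerivAt (S.RB ω) (S.β * deriv (S.Rslow ω) t - S.α * deriv (S.Rfast ω) t) t :=
    (hs.const_mul S.β).sub (hf.const_mul S.α)
  rw [radialWronskian, hin.deriv, hB.deriv, Rin_eq hc hd ht, RB, F, Wsf, radialWronskian]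
  ring

theorem exists_RB_eq_mul_Rin (hc : ∀ n : ℕ, S.c ω ≠ -(n : ℂ))
    (hd : ∀ n : ℤ, S.c ω - S.a ω - S.b ω ≠ n) (hF : S.F ω = 0) (hαβ : (S.α, S.β) ≠ (0, 0))
    {s : ℝ} (hs : s ∈ Ioo (0 : ℝ) 1) (hin : S.Rin ω s ≠ 0) :
    ∃ χ : ℂ, χ ≠ 0 ∧ ∀ t ∈ Ioo (0 : ℝ) 1, S.RB ω t = χ * S.Rin ω t := by
  rw [F] at hF
  rw [Rin_eq hc hd hs] at hin
  -- `F = 0` says that `(β, -α)` is proportional to `(Cslow, Cfast)`, and neither vector is zero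
  obtain ⟨χ, h1, h2⟩ : ∃ χ : ℂ, S.β = χ * S.Cslow ω ∧ -S.α = χ * S.Cfast ω := by
    by_cases h : S.Cslow ω = 0
    · have hf : S.Cfast ω ≠ 0 := fun h' => hin (by simp [h, h'])
      refine ⟨-S.α / S.Cfast ω, ?_, by field_simp⟩
      rw [h, mul_zero, zero_add] at hF
      rw [h, mul_zero, (mul_eq_zero.1 hF).resolve_right hf]
    · refine ⟨S.β / S.Cslow ω, by field_simp, ?_⟩
      field_simp
      linear_combination -hF
  refine ⟨χ, ?_, fun t ht => ?_⟩
  · rintro rfl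
    rw [zero_mul] at h1 h2
    exact hαβ (by rw [h1, neg_eq_zero.1 h2])
  · rw [RB, Rin_eq hc hd ht]
    linear_combination S.Rslow ω t * h1 + S.Rfast ω t * h2

/-! ### Analyticity in the frequency -/

theorem analyticAt_F (hA1 : S.AssumptionA1 U) (hω : ω ∈ U) (hc : ∀ n : ℕ, S.c ω ≠ -(n : ℂ))
    (hd : ∀ n : ℤ, S.c ω - S.a ω - S.b ω ≠ n) : AnalyticAt ℂ S.F ω := by
  have ha := hA1.1 ω hω
  have hb := hA1.2.1 ω hω
  have hcA := hA1.2.2 ω hω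
  have h1 := hcA.Gamma hc
  have h2 := ((hcA.fun_sub ha).fun_sub hb).Gamma fun n h => hd (-n) (by push_cast; exact h)
  have h3 := ((ha.fun_add hb).fun_sub hcA).Gamma fun n h => hd n (by
    push_cast
    linear_combination -h)
  have h4 := (h1.fun_mul h2).fun_mul
    ((hcA.fun_sub ha).Gamma_inv.fun_mul (hcA.fun_sub hb).Gamma_inv)
  have h5 := (h1.fun_mul h3).fun_mul (ha.Gamma_inv.fun_mul hb.Gamma_inv)
  refine (((analyticAt_const (v := S.α)).fun_mul h4).fun_add
    ((analyticAt_const (v := S.β)).fun_mul h5)).congr (Eventually.of_forall fun ω => ?_)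
  simp only [F, Cslow, Cfast, div_eq_mul_inv, mul_inv]

theorem analyticAt_ofReal_cpow {f : ℂ → ℂ} (hf : AnalyticAt ℂ f ω) {t : ℝ}
    (ht : t ∈ Ioo (0 : ℝ) 1) : AnalyticAt ℂ (fun ω => (t : ℂ) ^ f ω) ω :=
  analyticAt_const.cpow hf (slitPlane_of_mem_lens (ofReal_mem_lens ht))

theorem analyticAt_one_sub_ofReal_cpow {f : ℂ → ℂ} (hf : AnalyticAt ℂ f ω) {t : ℝ}
    (ht : t ∈ Ioo (0 : ℝ) 1) : AnalyticAt ℂ (fun ω => (1 - (t : ℂ)) ^ f ω) ω :=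
  analyticAt_const.cpow hf (one_sub_slitPlane_of_mem_lens (ofReal_mem_lens ht))

theorem analyticAt_prefactor (h₀ : AnalyticAt ℂ S.ρ₀ ω) (h₁ : AnalyticAt ℂ S.ρ₁ ω) {t : ℝ}
    (ht : t ∈ Ioo (0 : ℝ) 1) : AnalyticAt ℂ (fun ω => S.prefactor ω t) ω :=
  (analyticAt_ofReal_cpow h₀ ht).fun_mul (analyticAt_one_sub_ofReal_cpow h₁ ht)

theorem analyticAt_Rin (hA1 : S.AssumptionA1 U) (hω : ω ∈ U) (hc : ∀ n : ℕ, S.c ω ≠ -(n : ℂ))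
    (h₀ : AnalyticAt ℂ S.ρ₀ ω) (h₁ : AnalyticAt ℂ S.ρ₁ ω) {t : ℝ} (ht : t ∈ Ioo (0 : ℝ) 1) :
    AnalyticAt ℂ (fun ω => S.Rin ω t) ω :=
  (analyticAt_prefactor h₀ h₁ ht).fun_mul
    ((hA1.1 ω hω).ordinaryHypergeometric (hA1.2.1 ω hω) (hA1.2.2 ω hω) hc
      (mem_lens.1 (ofReal_mem_lens ht)).1)

theorem analyticAt_RB (hA1 : S.AssumptionA1 U) (hω : ω ∈ U)
    (hd : ∀ n : ℤ, S.c ω - S.a ω - S.b ω ≠ n)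
    (h₀ : AnalyticAt ℂ S.ρ₀ ω) (h₁ : AnalyticAt ℂ S.ρ₁ ω) {t : ℝ} (ht : t ∈ Ioo (0 : ℝ) 1) :
    AnalyticAt ℂ (fun ω => S.RB ω t) ω := by
  have ha := hA1.1 ω hω
  have hb := hA1.2.1 ω hω
  have hc := hA1.2.2 ω hω
  have hx := (mem_lens.1 (ofReal_mem_lens ht)).2
  have hs : AnalyticAt ℂ (fun ω => S.Rslow ω t) ω :=
    (analyticAt_prefactor h₀ h₁ ht).fun_mul
      (ha.ordinaryHypergeometric hb (((ha.fun_add hb).fun_sub hc).fun_add analyticAt_const)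
        (slow_param_ne hd) hx)
  have hf : AnalyticAt ℂ (fun ω => S.Rfast ω t) ω :=
    ((analyticAt_ofReal_cpow h₀ ht).fun_mul (analyticAt_one_sub_ofReal_cpow
      (((h₁.fun_add hc).fun_sub ha).fun_sub hb) ht)).fun_mul
      ((hc.fun_sub ha).ordinaryHypergeometric (hc.fun_sub hb)
        (((hc.fun_sub ha).fun_sub hb).fun_add analyticAt_const) (fast_param_ne hd) hx)
  exact (analyticAt_const.fun_mul hs).fun_sub (analyticAt_const.fun_mul hf)

theorem analyticAt_Wsf (hU : IsOpen U) (hA1 : S.AssumptionA1 U) (hA2 : S.AssumptionA2 U)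
    (hω : ω ∈ U) (h₀ : AnalyticAt ℂ S.ρ₀ ω) (h₁ : AnalyticAt ℂ S.ρ₁ ω) {t : ℝ}
    (ht : t ∈ Ioo (0 : ℝ) 1) : AnalyticAt ℂ (fun ω => S.Wsf ω t) ω := by
  have hc := hA1.2.2 ω hω
  have hd := (hc.fun_sub (hA1.1 ω hω)).fun_sub (hA1.2.1 ω hω)
  have h := ((analyticAt_prefactor h₀ h₁ ht).fun_pow 2).fun_mul (hd.fun_neg.fun_mul
    ((analyticAt_ofReal_cpow hc.fun_neg ht).fun_mul
      (analyticAt_one_sub_ofReal_cpow (hd.fun_sub (analyticAt_const (v := 1))) ht)))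
  refine h.congr ?_
  filter_upwards [hU.mem_nhds hω] with ω hω using (Wsf_eq (hA2 ω hω) ht).symm

end RadialProblem

/-! ### The double-pole criterion -/

theorem theorem2 (S : RadialProblem) (U : Set ℂ) (hU : IsOpen U) (ωs : ℂ) (hωs : ωs ∈ U)
    -- the problem: hypergeometric class, integrating factor, boundary functional
    (hclass : S.IsHypergeometricOn U) (hint : S.IsIndefiniteIntegralOn U)
    (hαβ : (S.α, S.β) ≠ (0, 0))
    -- `₂F₁(a, b; c; z)` and `Γ(c)` are defined
    (hc : ∀ ω ∈ U, ∀ n : ℕ, S.c ω ≠ -(n : ℂ))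
    (hA1 : S.AssumptionA1 U) (hA2 : S.AssumptionA2 U)
    (hA3 : S.AssumptionA3 U) (hA4 : S.AssumptionA4 U)
    (z z' : ℝ) (hz : z ∈ Ioo (0 : ℝ) 1) (hz' : z' ∈ Ioo (0 : ℝ) 1)
    -- the leading numerator coefficient does not vanish
    (hnum : S.Rin ωs (min z z') * S.RB ωs (max z z') ≠ 0) :
    -- pole of exact order two
    ((MeromorphicAt (S.G z z') ωs ∧ meromorphicOrderAt (S.G z z') ωs = -2) ↔
      (S.F ωs = 0 ∧ deriv S.F ωs = 0 ∧ deriv (deriv S.F) ωs ≠ 0)) ∧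
    -- the leading divergence, with the proportionality scalar `χ`
    ((S.F ωs = 0 ∧ deriv S.F ωs = 0 ∧ deriv (deriv S.F) ωs ≠ 0) →
      ∃ χ : ℂ, χ ≠ 0 ∧ (∀ t ∈ Ioo (0 : ℝ) 1, S.RB ωs t = χ * S.Rin ωs t) ∧
        (fun ω => S.G z z' ω -
            (-2 / (ω - ωs) ^ 2 *
              (χ * S.Rin ωs z * S.Rin ωs z' /
                (S.w ωs z' * S.Wsf ωs z' * deriv (deriv S.F) ωs))))
          =O[𝓝[≠] ωs] fun ω => 1 / (ω - ωs)) := by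
  have hmin : min z z' ∈ Ioo (0 : ℝ) 1 := by rcases min_choice z z' with h | h <;> rwa [h]
  have hmax : max z z' ∈ Ioo (0 : ℝ) 1 := by rcases max_choice z z' with h | h <;> rwa [h]
  obtain ⟨h₀, h₁⟩ := RadialProblem.analyticAt_exponents hU hclass hint hA1 hωs
  have hF := RadialProblem.analyticAt_F hA1 hωs (hc ωs hωs) (hA2 ωs hωs)
  -- `G = h / F`, where the weighted numerator `h` is analytic and does not vanish at `ωs`
  set h : ℂ → ℂ := fun ω => -(S.Rin ω (min z z') * S.RB ω (max z z')) / (S.w ω z' * S.Wsf ω z')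
    with hh
  have hhA : AnalyticAt ℂ h ωs :=
    ((RadialProblem.analyticAt_Rin hA1 hωs (hc ωs hωs) h₀ h₁ hmin).fun_mul
      (RadialProblem.analyticAt_RB hA1 hωs (hA2 ωs hωs) h₀ h₁ hmax)).fun_neg.fun_div
      ((hint.2 z' hz' ωs hωs).cexp'.fun_mul
        (RadialProblem.analyticAt_Wsf hU hA1 hA2 hωs h₀ h₁ hz')) (hA4 ωs hωs z' hz')
  have hh0 : h ωs ≠ 0 := div_ne_zero (neg_ne_zero.2 hnum) (hA4 ωs hωs z' hz')
  have hG : ∀ᶠ ω in 𝓝 ωs, S.G z z' ω = h ω / S.F ω := by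
    filter_upwards [hU.mem_nhds hωs] with ω hω
    rw [RadialProblem.G, RadialProblem.radialWronskian_Rin_RB (hc ω hω) (hA2 ω hω) hz',
      mul_neg, div_neg]
    simp only [hh]
    rw [div_div, neg_div, mul_assoc, mul_comm (S.F ω)]
  refine ⟨meromorphicOrderAt_div_eq_neg_two_iff hhA hh0 hF hG, fun hF2 => ?_⟩
  obtain ⟨χ, hχ, hprop⟩ := RadialProblem.exists_RB_eq_mul_Rin (hc ωs hωs) (hA2 ωs hωs) hF2.1 hαβ
    hmin (left_ne_zero_of_mul hnum)
  refine ⟨χ, hχ, hprop, ?_⟩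
  convert! div_sub_isBigO_of_double_zero hhA hF hG hF2 using 3 with ω
  have hsym : S.Rin ωs (min z z') * S.Rin ωs (max z z') = S.Rin ωs z * S.Rin ωs z' := by
    rcases le_total z z' with hle | hle
    · rw [min_eq_left hle, max_eq_right hle]
    · rw [min_eq_right hle, max_eq_left hle, mul_comm]
  have hval : h ωs = -(χ * S.Rin ωs z * S.Rin ωs z') / (S.w ωs z' * S.Wsf ωs z') := by
    rw [hh]
    simp only
    rw [hprop _ hmax, mul_left_comm, hsym, mul_assoc]
  rw [hval, div_div]
  ring
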